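/- **Definitions.** For a finite set $I$ and $P\subseteq[0,1]^I$ let $\mathrm{cone}(P)=\{(\lambda,\lambda x):\lambda\ge 0,\ x\in P\}\subseteq\mathbb R^{\{0\}\cup I}$. Let $\mathrm{LS}_+(P)$ be the set of all $x\in\mathbb R^I$ for which there is a real symmetric positive semidefinite matrix $Y$ indexed by $\{0\}\cup I$ with $Ye_0=\mathrm{diag}(Y)=(1,x)$ and $Ye_i,\ Y(e_0-e_i)\in\mathrm{cone}(P)$ for all $i\in I$. Put $\mathrm{LS}_+^0(P)=P$ and $\mathrm{LS}_+^{m}(P)=\mathrm{LS}_+(\mathrm{LS}_+^{m-1}(P))$ for $m\ge 1$. For a finite simple graph $G$ let $\mathrm{FRAC}(G)=\{x\in[0,1]^{V(G)}:x_u+x_w\le 1\text{ for all }\{u,w\}\in E(G)\}$, let $\mathrm{STAB}(G)$ be the convex hull of the $0$-$1$ vectors in $\mathrm{FRAC}(G)$, write $\mathrm{LS}_+^m(G)=\mathrm{LS}_+^m(\mathrm{FRAC}(G))$, and let $r_+(G)$ be the smallest $m\ge 0$ with $\mathrm{LS}_+^m(G)=\mathrm{STAB}(G)$. Let $\omega(G)$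 and $\alpha(G)$ denote the clique number and the stability number of $G$. To $2$-stretch a vertex $v$ of a graph with neighbourhood $\Gamma(v)$, choose (possibly empty) sets $A_1,A_2$ with $A_1\cup A_2=\Gamma(v)$, replace $v$ by three vertices $v_0,v_1,v_2$, and for $j=1,2$ join $v_j$ to $v_0$ and to every vertex of $A_j$. For integers $n\ge 3$ and $d\ge 0$ let $\mathcal K_{n,d}$ be the set of graphs obtained from the complete graph $K_n$ on $\{1,\dots,n\}$ by $2$-stretching $d$ of its $n$ vertices, one after another; let $D(G)$ be the set of stretched vertices, and for $i\in D(G)$ call $i_0$ a hub. Let $\hat{\mathcal K}_{n,d}$ be the set of $G\in\mathcal K_{n,d}$ such that for all distinct $i,j\in D(G)$ exactly one of the pairs $\{i_1,j_1\},\{i_1,j_2\},\{i_2,j_1\},\{i_2,j_2\}$ is an edge of $G$. For $G\in\mathcal K_{n,d}$ and $\varepsilon>0$ put $$v(G,\varepsilon)=\sum_{\substack{z\in\{0,1\}^{V(G)}\cap\mathrm{FRAC}(G)\\ \bar e^\top z=d+1}}\begin{bmatrix}1\\ z\end{bmatrix}-\varepsilon\begin{bmatrix}1\\ \chi_{D_0}\end{bmatrix}\in\mathbb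 R^{\{0\}\cup V(G)},$$ where $\bar e$ is the all-ones vector and $\chi_{D_0}$ is the incidence vector of the set $D_0$ of hubs of $G$. **Theorem.** Let $n\ge 3$ and $d\ge 0$ be integers, let $G\in\hat{\mathcal K}_{n,d}$, and let $k=\max\{3,\omega(G)\}$. Then $k\le n$ and $\alpha(G)=d+1$, and there is an $\varepsilon>0$ such that $v(G,\varepsilon)\in\mathrm{cone}(\mathrm{LS}_+^{n-k}(G))$ while $v(G,\varepsilon)$ violates the (homogenized) rank inequality $\bar e^\top x\le d+1$ of $G$, that is, $\sum_{u\in V(G)}v(G,\varepsilon)_u>(d+1)\,v(G,\varepsilon)_0$. Moreover, $r_+(G)\ge n-k+1$. -/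

import Mathlib

/-! ### The operator `LS₊` -/

section LovaszSchrijver

variable {ι : Type*}

/-- The homogenized cone `{(λ, λ x) : λ ≥ 0, x ∈ P}` of a set `P ⊆ ℝ^ι`. The additional
coordinate, called `0` on paper, is `none`. -/
def homCone (P : Set (ι → ℝ)) : Set (Option ι → ℝ) :=
  {y | ∃ t : ℝ, 0 ≤ t ∧ ∃ x ∈ P, y none = t ∧ ∀ i, y (some i) = t * x i}

/-- The lifted set of `LS₊`: the symmetric positive semidefinite matrices `Y` with
`Y e₀ = diag Y` and `Y eᵢ, Y (e₀ - eᵢ) ∈ cone P` for all `i`. -/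
def LSplusLift (P : Set (ι → ℝ)) : Set (Matrix (Option ι) (Option ι) ℝ) :=
  {Y | Y.PosSemidef ∧ Y.col none = Y.diag ∧
    ∀ i : ι, Y.col (some i) ∈ homCone P ∧ Y.col none - Y.col (some i) ∈ homCone P}

/-- `LS₊(P)`, the set of all `x` with `Y e₀ = (1, x)` for some `Y` in the lifted set. -/
def LSplus (P : Set (ι → ℝ)) : Set (ι → ℝ) :=
  {x | ∃ Y ∈ LSplusLift P, Y.col none none = 1 ∧ ∀ i, Y.col none (some i) = x i}

/-- The integer hull `P_I`: the convex hull of the `0`-`1` points of `P`. -/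
def integerHull (P : Set (ι → ℝ)) : Set (ι → ℝ) :=
  convexHull ℝ {x | x ∈ P ∧ ∀ i, x i = 0 ∨ x i = 1}

/-- The `LS₊`-rank of `P`: the least `m` with `LS₊^m(P) = P_I`. -/
noncomputable def LSplusRank (P : Set (ι → ℝ)) : ℕ∞ :=
  ⨅ (m : ℕ) (_ : LSplus^[m] P = integerHull P), (m : ℕ∞)

/-- The incidence vector of a set. -/
noncomputable def incidence (S : Set ι) : ι → ℝ := S.indicator 1

/-- The vector `(1, x)`. -/
def homVec (x : ι → ℝ) : Option ι → ℝ := fun o => o.elim 1 x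

open Classical in
/-- The sum of the vectors `(1, z)` over all `0`-`1` points `z ∈ P` with `cᵀ z = c₀`. The `0`-`1`
points are enumerated as the incidence vectors of the subsets of `ι`. -/
noncomputable def faceSum [Fintype ι] (P : Set (ι → ℝ)) (c : ι → ℝ) (c₀ : ℝ) :
    Option ι → ℝ :=
  ∑ S : Finset ι with
    incidence (S : Set ι) ∈ P ∧ ∑ i, c i * incidence (S : Set ι) i = c₀,
    homVec (incidence (S : Set ι))

end LovaszSchrijver

/-! ### Stable set polytopes -/

/-- The fractional stable set polytope. -/
def fracStab {V : Type*} (G : SimpleGraph V) : Set (V → ℝ) :=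
  {x | (∀ v, 0 ≤ x v ∧ x v ≤ 1) ∧ ∀ u v, G.Adj u v → x u + x v ≤ 1}

/-- The `LS₊`-rank `r₊(G)` of a graph, that of its fractional stable set polytope. (The integer
hull of `fracStab G` is the stable set polytope.) -/
noncomputable def graphLSplusRank {V : Type*} (G : SimpleGraph V) : ℕ∞ :=
  LSplusRank (fracStab G)

/-! ### Stretched cliques -/

/-- The `2`-stretching of the vertex `v` with the sets `A₁`, `A₂` of neighbours: `v` is replaced by
`v₀, v₁, v₂` (these are `inr 0`, `inr 1`, `inr 2`), and `v_j` is joined to `v₀` and to all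
vertices in `A_j`, for `j = 1, 2`. -/
def twoStretch {V : Type*} (G : SimpleGraph V) (v : V) (A₁ A₂ : Set V) :
    SimpleGraph ({u : V // u ≠ v} ⊕ Fin 3) where
  Adj
    | .inl u, .inl w => G.Adj u w
    | .inl u, .inr j => (j = 1 ∧ (u : V) ∈ A₁) ∨ (j = 2 ∧ (u : V) ∈ A₂)
    | .inr j, .inl u => (j = 1 ∧ (u : V) ∈ A₁) ∨ (j = 2 ∧ (u : V) ∈ A₂)
    | .inr i, .inr j => (i = 0 ∧ j ≠ 0) ∨ (i ≠ 0 ∧ j = 0)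
  symm := ⟨by
    rintro (u | i) (w | j) h
    · exact G.symm.symm _ _ h
    · exact h
    · exact h
    · tauto⟩
  loopless := ⟨by
    rintro (u | i) h
    · exact G.loopless.irrefl _ h
    · tauto⟩

/-- The names of the vertices of a graph that arises from `K_n` by stretching vertices: an
unstretched vertex `i`, or one of the three vertices `i₀` (hub), `i₁`, `i₂` (wings) that have
replaced `i`. -/
inductive CliqueLabel (n : ℕ) : Type
  | unstretched (i : Fin n) : CliqueLabel n
  | stretched (i : Fin n) (j : Fin 3) : CliqueLabel n

/-- `IsStretchedClique n d G label`: the graph `G` is obtained (up to isomorphism) from `K_n` by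
`2`-stretching `d` of the `n` vertices, one after another, and `label` records the names of the
vertices of `G` in this construction. -/
inductive IsStretchedClique.{u} (n : ℕ) :
    ℕ → ∀ {V : Type u}, SimpleGraph V → (V → CliqueLabel n) → Prop
  | complete {V : Type u} (e : V ≃ Fin n) :
      IsStretchedClique n 0 (⊤ : SimpleGraph V) (fun v => .unstretched (e v))
  | stretch {d : ℕ} {V : Type u} {G : SimpleGraph V} {label : V → CliqueLabel n}
      (h : IsStretchedClique n d G label) (v : V) (i : Fin n) (hv : label v = .unstretched i)
      (A₁ A₂ : Set V) (hA : A₁ ∪ A₂ = G.neighborSet v) :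
      IsStretchedClique n (d + 1) (twoStretch G v A₁ A₂)
        (Sum.elim (fun u => label u) (fun j => .stretched i j))
  | iso {d : ℕ} {V W : Type u} {G : SimpleGraph V} {G' : SimpleGraph W}
      {label : V → CliqueLabel n}
      (h : IsStretchedClique n d G label) (e : G' ≃g G) :
      IsStretchedClique n d G' (fun w => label (e w))

/-- The set of indices `D(G)` of the vertices of `K_n` that were stretched. -/
def stretchedIndices {n : ℕ} {V : Type*} (label : V → CliqueLabel n) : Set (Fin n) :=
  {i | ∃ v j, label v = .stretched i j}

/-- The set of hub vertices. -/
def hubs {n : ℕ} {V : Type*} (label : V → CliqueLabel n) : Set V :=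
  {v | ∃ i, label v = .stretched i 0}

/-- The class `K̂_{n,d}`: the stretched cliques in which, for any two distinct stretched indices
`i`, `j`, exactly one of `i₁j₁`, `i₁j₂`, `i₂j₁`, `i₂j₂` is an edge. -/
def IsHatStretchedClique (n d : ℕ) {V : Type*} (G : SimpleGraph V)
    (label : V → CliqueLabel n) : Prop :=
  IsStretchedClique n d G label ∧
    ∀ i ∈ stretchedIndices label, ∀ j ∈ stretchedIndices label, i ≠ j →
      {e ∈ G.edgeSet | ∃ u w : V, ∃ a b : Fin 3, a ≠ 0 ∧ b ≠ 0 ∧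
        label u = .stretched i a ∧ label w = .stretched j b ∧ e = s(u, w)}.ncard = 1

/-- The vector `v(G, ε)`: the sum of `(1, z)` over all `0`-`1` points `z` of the fractional stable
set polytope with coordinate sum `d + 1`, minus `ε (1, χ)`, `χ` the incidence vector of the set of
hubs. -/
noncomputable def stretchPoint {n : ℕ} (d : ℕ) {V : Type*} [Fintype V] (G : SimpleGraph V)
    (label : V → CliqueLabel n) (ε : ℝ) : Option V → ℝ :=
  faceSum (fracStab G) (fun _ => 1) (d + 1) - ε • homVec (incidence (hubs label))

/-! ### Homogenized cones and iterates of `LSplus`. -/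

section LovaszSchrijverCone

variable {ι : Type*}

/-! The vertices of a stretched clique fall into `n` fibers, one for each vertex of `K_n`. Take the
set `H` of hubs and switch one fiber from its hub (if any) to all its non-hubs: this gains one
vertex. Any two fibers are joined by an edge, so no stable set can gain twice, and the stability
number is `d + 1`. All summands of `v(G, ε)` are tight for the rank inequality, while `X = (1, χ_H)`
has slack, so subtracting `ε X` produces a violation.

Membership is an induction on `m` over sets `I` of indices (`sum_sub_mem_homCone`). Let `Z_I` be the
set of maximum stable sets agreeing with `H` outside `I`. If `|I| ≥ m + 3`, all cliques inside `I`
have at most `|I| - m` vertices and `ε` is small, then the sum of `(1, χ_S)` over `Z_I` minus `ε X`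
lies in the cone of the `m`-th iterate. For `m = 0` a third fiber provides the slack in every edge
inequality.

In the step no clique meets all fibers of `I`, and then some stretched index of `I` is a pivot
(`exists_isPivot`): its wings `j₁`, `j₂` miss entire fibers `a ≠ b` of `I`. The certificate is `∑ S
Sᵀ - ε X Xᵀ + ε M`, with homogenized incidence vectors `S`. Fixing a vertex of index `i ∈ I` leads
to `Z_{I∖i}`, so without `M` the column conditions would follow by induction; but `-ε X Xᵀ`
endangers semidefiniteness. The symmetric matrix `M` is made of differences of stable sets, has zero
first column and zero diagonal, and turns the coefficient of `X²` in the quadratic form from `-ε`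
into `+ε`; the rest is dominated by `∑ S Sᵀ` (`posSemidef_pivot`). It alters only the columns of
three fibers, and there the change is absorbed by stable sets and by raising `ε` to at most `3ε` in
the induction hypothesis (`column_mem`). -/

theorem mem_homCone_of_one {P : Set (ι → ℝ)} {x : ι → ℝ} (hx : x ∈ P) : homVec x ∈ homCone P :=
  ⟨1, zero_le_one, x, hx, rfl, fun i => (one_mul (x i)).symm⟩

theorem homCone_smul {P : Set (ι → ℝ)} {c : ℝ} (hc : 0 ≤ c) {y : Option ι → ℝ}
    (hy : y ∈ homCone P) : c • y ∈ homCone P := by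
  obtain ⟨t, ht, x, hx, h0, h⟩ := hy
  refine ⟨c * t, mul_nonneg hc ht, x, hx, ?_, fun i => ?_⟩
  · simp [h0]
  · simp [h, mul_assoc]

theorem zero_mem_homCone {P : Set (ι → ℝ)} (hP : P.Nonempty) : (0 : Option ι → ℝ) ∈ homCone P := by
  obtain ⟨x, hx⟩ := hP
  exact ⟨0, le_rfl, x, hx, rfl, fun i => by simp⟩

theorem homCone_add {P : Set (ι → ℝ)} (hP : Convex ℝ P) {y z : Option ι → ℝ}
    (hy : y ∈ homCone P) (hz : z ∈ homCone P) : y + z ∈ homCone P := by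
  obtain ⟨t, ht, x, hx, h0, h⟩ := hy
  obtain ⟨s, hs, w, hw, h0', h'⟩ := hz
  rcases (add_nonneg ht hs).eq_or_lt with h00 | hpos
  · have ht0 : t = 0 := by linarith
    have hs0 : s = 0 := by linarith
    refine ⟨0, le_rfl, x, hx, ?_, fun i => ?_⟩
    · simp [h0, h0', ht0, hs0]
    · simp [h, h', ht0, hs0]
  · refine ⟨t + s, hpos.le, (t / (t + s)) • x + (s / (t + s)) • w,
      hP hx hw (by positivity) (by positivity) (by field_simp), ?_, fun i => ?_⟩
    · simp [h0, h0']
    · simp only [Pi.add_apply, h, h', Pi.smul_apply, smul_eq_mul]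
      field_simp

theorem mem_of_mem_homCone {P : Set (ι → ℝ)} {y : Option ι → ℝ} (hy : y ∈ homCone P)
    (h0 : y none = 1) : (fun i => y (some i)) ∈ P := by
  obtain ⟨t, ht, x, hx, h0', h⟩ := hy
  have : t = 1 := by rw [← h0', h0]
  subst this
  convert hx using 1
  funext i
  simp [h]

/-- A homogeneous form of membership in `LS₊(P)`. -/
theorem col_none_mem_homCone_LSplus {P : Set (ι → ℝ)} {Y : Matrix (Option ι) (Option ι) ℝ}
    (hY : Y ∈ LSplusLift P) (h0 : 0 < Y none none) : Y.col none ∈ homCone (LSplus P) := by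
  obtain ⟨hps, hd, hc⟩ := hY
  have hpos : 0 ≤ (Y none none)⁻¹ := (inv_pos.2 h0).le
  refine ⟨Y none none, h0.le, fun i => (Y none none)⁻¹ * Y (some i) none,
    ⟨(Y none none)⁻¹ • Y, ⟨hps.smul hpos, ?_, fun i => ⟨?_, ?_⟩⟩, ?_, fun i => ?_⟩, rfl, fun i => ?_⟩
  · funext o
    have := congrFun hd o
    simp only [Matrix.col_apply, Matrix.diag_apply, Matrix.smul_apply] at this ⊢
    rw [this]
  · exact homCone_smul hpos (hc i).1
  · have := homCone_smul hpos (hc i).2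
    rwa [smul_sub] at this
  · simp [h0.ne']
  · simp
  · simp [h0.ne']

theorem convex_LSplus {P : Set (ι → ℝ)} (hP : Convex ℝ P) : Convex ℝ (LSplus P) := by
  rintro x ⟨Y, ⟨hps, hd, hc⟩, h1, hx⟩ w ⟨Z, ⟨hps', hd', hc'⟩, h1', hw⟩ s t hs ht hst
  refine ⟨s • Y + t • Z, ⟨(hps.smul hs).add (hps'.smul ht), ?_, fun i => ⟨?_, ?_⟩⟩, ?_, fun i => ?_⟩
  · funext o
    have h1 := congrFun hd o
    have h2 := congrFun hd' o
    simp only [Matrix.col_apply, Matrix.diag_apply, Matrix.smul_apply, Matrix.add_apply] at h1 h2 ⊢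
    rw [h1, h2]
  · exact homCone_add hP (homCone_smul hs (hc i).1) (homCone_smul ht (hc' i).1)
  · have := homCone_add hP (homCone_smul hs (hc i).2) (homCone_smul ht (hc' i).2)
    convert this using 1
    funext o
    simp
    ring
  · simp only [Matrix.col_apply, Matrix.add_apply, Matrix.smul_apply, smul_eq_mul] at h1 h1' ⊢
    rw [h1, h1']; linarith
  · have h2 := hx i
    have h3 := hw i
    simp only [Matrix.col_apply, Matrix.add_apply, Matrix.smul_apply, smul_eq_mul, Pi.add_apply,
      Pi.smul_apply] at h2 h3 ⊢
    rw [h2, h3]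

/-- `Y e₀` is the sum of `Y eᵢ` and `Y (e₀ - eᵢ)`; one index `i` is needed for this. -/
theorem LSplus_subset [Nonempty ι] {P : Set (ι → ℝ)} (hP : Convex ℝ P) : LSplus P ⊆ P := by
  rintro x ⟨Y, ⟨-, -, hc⟩, h1, hx⟩
  obtain ⟨i⟩ := ‹Nonempty ι›
  have h := homCone_add hP (hc i).1 (hc i).2
  rw [add_sub_cancel] at h
  convert mem_of_mem_homCone h h1 using 1
  funext i
  exact (hx i).symm

/-- The rank-one matrix `(1, x)(1, x)ᵀ` works, since its columns are `0` or `(1, x)`. -/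
theorem mem_LSplus_of_zero_one [Finite ι] {P : Set (ι → ℝ)} {x : ι → ℝ} (hx : x ∈ P)
    (h01 : ∀ i, x i = 0 ∨ x i = 1) : x ∈ LSplus P := by
  have hcol : ∀ o, (Matrix.vecMulVec (homVec x) (homVec x)).col o = homVec x o • homVec x := by
    intro o
    funext p
    simp [Matrix.vecMulVec_apply, mul_comm]
  have hnone : homVec x none = 1 := rfl
  have hmem := mem_homCone_of_one hx
  refine ⟨Matrix.vecMulVec (homVec x) (homVec x), ⟨?_, ?_, fun i => ⟨?_, ?_⟩⟩, ?_, fun i => ?_⟩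
  · simpa using Matrix.posSemidef_vecMulVec_self_star (homVec x)
  · rw [hcol]
    funext o
    rcases o with _ | i
    · simp [Matrix.vecMulVec_apply, hnone]
    · rcases h01 i with h | h <;> simp [Matrix.vecMulVec_apply, homVec, h]
  · rw [hcol]
    refine homCone_smul ?_ hmem
    rcases h01 i with h | h <;> simp [homVec, h]
  · rw [hcol, hcol, ← sub_smul]
    refine homCone_smul ?_ hmem
    rcases h01 i with h | h <;> simp [homVec, h]
  · rw [hcol]; simp [hnone]
  · rw [hcol]; simp [homVec]

theorem convex_iterate_LSplus {P : Set (ι → ℝ)} (hP : Convex ℝ P) (m : ℕ) :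
    Convex ℝ (LSplus^[m] P) := by
  induction m with
  | zero => exact hP
  | succ m ih => rw [Function.iterate_succ_apply']; exact convex_LSplus ih

theorem mem_iterate_LSplus_of_zero_one [Finite ι] {P : Set (ι → ℝ)} {x : ι → ℝ} (hx : x ∈ P)
    (h01 : ∀ i, x i = 0 ∨ x i = 1) (m : ℕ) : x ∈ LSplus^[m] P := by
  induction m with
  | zero => exact hx
  | succ m ih => rw [Function.iterate_succ_apply']; exact mem_LSplus_of_zero_one ih h01

theorem antitone_iterate_LSplus [Nonempty ι] {P : Set (ι → ℝ)} (hP : Convex ℝ P) :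
    Antitone fun m => LSplus^[m] P :=
  antitone_nat_of_succ_le fun m => by
    rw [Function.iterate_succ_apply']
    exact LSplus_subset (convex_iterate_LSplus hP m)

end LovaszSchrijverCone

/-! ### The fractional stable set polytope and incidence vectors. -/

theorem convex_fracStab {V : Type*} (G : SimpleGraph V) : Convex ℝ (fracStab G) := by
  rintro x ⟨hx, hx'⟩ y ⟨hy, hy'⟩ s t hs ht hst
  refine ⟨fun v => ⟨?_, ?_⟩, fun u v huv => ?_⟩
  · have := (hx v).1; have := (hy v).1
    simp only [Pi.add_apply, Pi.smul_apply, smul_eq_mul]; positivity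
  · simp only [Pi.add_apply, Pi.smul_apply, smul_eq_mul]
    nlinarith [(hx v).2, (hy v).2]
  · simp only [Pi.add_apply, Pi.smul_apply, smul_eq_mul]
    nlinarith [hx' u v huv, hy' u v huv]

theorem mem_homCone_fracStab {V : Type*} {G : SimpleGraph V} {y : Option V → ℝ}
    (h0 : 0 < y none) (hy : ∀ v, 0 ≤ y (some v)) (hy' : ∀ v, y (some v) ≤ y none)
    (hadj : ∀ u v, G.Adj u v → y (some u) + y (some v) ≤ y none) : y ∈ homCone (fracStab G) := by
  refine ⟨y none, h0.le, fun v => y (some v) / y none,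
    ⟨fun v => ⟨div_nonneg (hy v) h0.le, (div_le_one h0).2 (hy' v)⟩, fun u v huv => ?_⟩, rfl,
    fun v => ?_⟩
  · rw [← add_div]
    exact (div_le_one h0).2 (hadj u v huv)
  · field_simp

theorem incidence_apply {V : Type*} (S : Set V) (v : V) [Decidable (v ∈ S)] :
    incidence S v = if v ∈ S then 1 else 0 := by
  simp [incidence, Set.indicator_apply]

theorem incidence_eq_zero_or_one {V : Type*} (S : Set V) (v : V) :
    incidence S v = 0 ∨ incidence S v = 1 := by
  classical
  rw [incidence_apply]
  split_ifs <;> simp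

theorem incidence_mem_fracStab_iff {V : Type*} {G : SimpleGraph V} {S : Set V} :
    incidence S ∈ fracStab G ↔ G.IsIndepSet S := by
  classical
  constructor
  · intro h u hu v hv _ huv
    have := h.2 u v huv
    simp only [incidence_apply, hu, hv, if_true] at this
    norm_num at this
  · intro h
    refine ⟨fun v => ?_, fun u v huv => ?_⟩
    · rw [incidence_apply]; split_ifs <;> simp
    · rw [incidence_apply, incidence_apply]
      split_ifs with hu hv hv
      · exact absurd huv (h hu hv huv.ne)
      all_goals norm_num

/-! ### Combinatorics of the labels of stretched cliques. -/

/-- The vertex of `K_n` a label comes from. -/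
def CliqueLabel.idx {n : ℕ} : CliqueLabel n → Fin n
  | .unstretched i => i
  | .stretched i _ => i

/-- The labels of hubs. -/
def CliqueLabel.IsHub {n : ℕ} : CliqueLabel n → Prop
  | .unstretched _ => False
  | .stretched _ j => j = 0

/-- The structure that the labels of a stretched clique with stretched indices `D` satisfy. -/
structure IsStretchedLabelling {n : ℕ} (D : Set (Fin n)) {V : Type*} (G : SimpleGraph V)
    (label : V → CliqueLabel n) : Prop where
  injective : Function.Injective label
  unstretched_iff : ∀ i, (∃ v, label v = .unstretched i) ↔ i ∉ D
  stretched_iff : ∀ i j, (∃ v, label v = .stretched i j) ↔ i ∈ D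
  adj_hub : ∀ h w, (label h).IsHub →
    (G.Adj h w ↔ (label w).idx = (label h).idx ∧ ¬ (label w).IsHub)
  not_adj : ∀ u w, ¬ (label u).IsHub → ¬ (label w).IsHub → (label u).idx = (label w).idx →
    ¬ G.Adj u w
  cross : ∀ i j, i ≠ j → ∃ u w, ¬ (label u).IsHub ∧ ¬ (label w).IsHub ∧ (label u).idx = i ∧
    (label w).idx = j ∧ G.Adj u w

namespace IsStretchedLabelling

variable {n : ℕ} {D : Set (Fin n)} {V : Type*} {G : SimpleGraph V} {label : V → CliqueLabel n}

theorem notMem_of_label_eq (h : IsStretchedLabelling D G label) {v : V} {i : Fin n}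
    (hv : label v = .unstretched i) : i ∉ D :=
  (h.unstretched_iff i).1 ⟨v, hv⟩

theorem eq_of_idx_eq (h : IsStretchedLabelling D G label) {v u : V} {i : Fin n}
    (hv : label v = .unstretched i) (hu : (label u).idx = i) : u = v := by
  apply h.injective
  rw [hv]
  rcases hl : label u with k | ⟨k, j⟩
  · rw [hl] at hu
    exact congrArg _ hu
  · rw [hl] at hu
    obtain rfl : k = i := hu
    exact absurd ((h.stretched_iff k j).1 ⟨u, hl⟩) (h.notMem_of_label_eq hv)

theorem complete (e : V ≃ Fin n) :
    IsStretchedLabelling (∅ : Set (Fin n)) (⊤ : SimpleGraph V) (fun v => .unstretched (e v)) where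
  injective u w h := by simpa using h
  unstretched_iff i := by simpa using ⟨e.symm i, by simp⟩
  stretched_iff i j := by simp
  adj_hub h w hh := by simp [CliqueLabel.IsHub] at hh
  not_adj u w _ _ h := by
    have : u = w := by simpa [CliqueLabel.idx] using h
    simp [this]
  cross i j hij := ⟨e.symm i, e.symm j, by simp [CliqueLabel.IsHub], by simp [CliqueLabel.IsHub],
    by simp [CliqueLabel.idx], by simp [CliqueLabel.idx], by simpa using hij⟩

theorem iso (h : IsStretchedLabelling D G label) {W : Type*} {G' : SimpleGraph W} (e : G' ≃g G) :
    IsStretchedLabelling D G' (fun w => label (e w)) where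
  injective := h.injective.comp e.injective
  unstretched_iff i := by
    rw [← h.unstretched_iff i]
    exact ⟨fun ⟨v, hv⟩ => ⟨_, hv⟩, fun ⟨v, hv⟩ => ⟨e.symm v, by simpa using hv⟩⟩
  stretched_iff i j := by
    rw [← h.stretched_iff i j]
    exact ⟨fun ⟨v, hv⟩ => ⟨_, hv⟩, fun ⟨v, hv⟩ => ⟨e.symm v, by simpa using hv⟩⟩
  adj_hub u w hu := by rw [← h.adj_hub _ _ hu, e.map_adj_iff]
  not_adj u w hu hw huw := by
    rw [← e.map_adj_iff]
    exact h.not_adj _ _ hu hw huw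
  cross i j hij := by
    obtain ⟨u, w, hu, hw, hui, hwj, huw⟩ := h.cross i j hij
    exact ⟨e.symm u, e.symm w, by simpa using hu, by simpa using hw, by simpa using hui,
      by simpa using hwj, by rw [← e.map_adj_iff]; simpa using huw⟩

/-- An edge at `v` survives at one of the new wings because `A₁ ∪ A₂` is the whole neighbourhood. An
older hub is not adjacent to `v`, so it lies in neither `A₁` nor `A₂` and keeps its neighbours. -/
theorem stretch (h : IsStretchedLabelling D G label) {v : V} {i : Fin n}
    (hv : label v = .unstretched i) {A₁ A₂ : Set V} (hA : A₁ ∪ A₂ = G.neighborSet v) :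
    IsStretchedLabelling (insert i D) (twoStretch G v A₁ A₂)
      (Sum.elim (fun u => label u) (fun j => .stretched i j)) := by
  have hiD := h.notMem_of_label_eq hv
  have hidx : ∀ u : {u : V // u ≠ v}, (label u).idx ≠ i := fun u hu =>
    u.2 (h.eq_of_idx_eq hv hu)
  have hcross : ∀ j, i ≠ j → ∃ u w, ¬ (Sum.elim (fun u : {u : V // u ≠ v} => label u)
      (fun j => CliqueLabel.stretched i j) u).IsHub ∧ ¬ (Sum.elim (fun u : {u : V // u ≠ v} =>
      label u) (fun j => CliqueLabel.stretched i j) w).IsHub ∧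
      (Sum.elim (fun u : {u : V // u ≠ v} => label u)
      (fun j => CliqueLabel.stretched i j) u).idx = i ∧ (Sum.elim (fun u : {u : V // u ≠ v} =>
      label u) (fun j => CliqueLabel.stretched i j) w).idx = j ∧
      (twoStretch G v A₁ A₂).Adj u w := by
    intro j hij
    obtain ⟨u, w, hu, hw, hui, hwj, huw⟩ := h.cross i j hij
    obtain rfl := h.eq_of_idx_eq hv hui
    have hwA : w ∈ A₁ ∪ A₂ := by rw [hA]; exact huw
    rcases hwA with hwA | hwA
    · exact ⟨.inr 1, .inl ⟨w, huw.ne'⟩, by simp [CliqueLabel.IsHub], by simpa using hw, rfl, hwj,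
        by simp [twoStretch, hwA]⟩
    · exact ⟨.inr 2, .inl ⟨w, huw.ne'⟩, by simp [CliqueLabel.IsHub], by simpa using hw, rfl, hwj,
        by simp [twoStretch, hwA]⟩
  refine ⟨?_, fun k => ?_, fun k j => ?_, ?_, ?_, fun p q hpq => ?_⟩
  · rintro (u | a) (w | b) huw
    · exact congrArg _ (Subtype.ext (h.injective huw))
    · exact absurd (congrArg CliqueLabel.idx huw) (hidx u)
    · exact absurd (congrArg CliqueLabel.idx huw).symm (hidx w)
    · simpa using huw
  · rw [Set.mem_insert_iff, not_or, ← h.unstretched_iff k]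
    constructor
    · rintro ⟨u | a, hu⟩
      · exact ⟨fun hk => hidx u ((congrArg CliqueLabel.idx hu).trans hk), u, hu⟩
      · simp at hu
    · rintro ⟨hk, u, hu⟩
      refine ⟨.inl ⟨u, ?_⟩, hu⟩
      rintro rfl
      rw [hv] at hu
      exact hk (by simpa using hu.symm)
  · rw [Set.mem_insert_iff, ← h.stretched_iff k j]
    constructor
    · rintro ⟨u | a, hu⟩
      · exact Or.inr ⟨u, hu⟩
      · simp only [Sum.elim_inr, CliqueLabel.stretched.injEq] at hu
        exact Or.inl hu.1.symm
    · rintro (rfl | ⟨u, hu⟩)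
      · exact ⟨.inr j, rfl⟩
      · refine ⟨.inl ⟨u, ?_⟩, hu⟩
        rintro rfl
        rw [hv] at hu
        simp at hu
  · rintro (u | a) (w | b) hh
    · exact h.adj_hub _ _ hh
    · have hnadj : ¬ G.Adj u v := by
        rw [h.adj_hub _ _ hh, hv]
        exact fun h' => hidx u h'.1.symm
      have h1 : ((u : V)) ∉ A₁ ∪ A₂ := by
        rw [hA]
        exact fun h' => hnadj (G.symm.symm _ _ h')
      rw [Set.mem_union, not_or] at h1
      have h2 := hidx u
      simp only [twoStretch, Sum.elim_inl, Sum.elim_inr, h1, and_false, or_false, false_iff]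
      exact fun h' => h2 h'.1.symm
    · have ha : a = 0 := hh
      have h2 := hidx w
      simp only [twoStretch, ha, Sum.elim_inl, Sum.elim_inr]
      simp only [CliqueLabel.idx] at h2 ⊢
      simp [h2]
    · have ha : a = 0 := hh
      simp [twoStretch, ha, CliqueLabel.idx, CliqueLabel.IsHub]
  · rintro (u | a) (w | b) hu hw huw
    · exact h.not_adj _ _ hu hw huw
    · exact absurd huw (hidx u)
    · exact absurd huw.symm (hidx w)
    · have ha : a ≠ 0 := hu
      have hb : b ≠ 0 := hw
      simp [twoStretch, ha, hb]
  · by_cases hp : p = i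
    · subst hp
      exact hcross q hpq
    by_cases hq : q = i
    · subst hq
      obtain ⟨u, w, h1, h2, h3, h4, h5⟩ := hcross p hpq.symm
      exact ⟨w, u, h2, h1, h4, h3, h5.symm⟩
    obtain ⟨u, w, hu, hw, hup, hwq, huw⟩ := h.cross p q hpq
    refine ⟨.inl ⟨u, ?_⟩, .inl ⟨w, ?_⟩, hu, hw, hup, hwq, huw⟩
    · rintro rfl
      rw [hv] at hup
      exact hp hup.symm
    · rintro rfl
      rw [hv] at hwq
      exact hq hwq.symm

end IsStretchedLabelling

theorem IsStretchedClique.exists_labelling {n d : ℕ} {V : Type*} {G : SimpleGraph V}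
    {label : V → CliqueLabel n} (h : IsStretchedClique n d G label) :
    ∃ D : Set (Fin n), D.ncard = d ∧ IsStretchedLabelling D G label := by
  induction h with
  | complete e => exact ⟨∅, by simp, .complete e⟩
  | stretch h v i hv A₁ A₂ hA ih =>
    obtain ⟨D, hD, hL⟩ := ih
    exact ⟨insert i D, by rw [Set.ncard_insert_of_notMem (hL.notMem_of_label_eq hv), hD],
      hL.stretch hv hA⟩
  | iso h e ih =>
    obtain ⟨D, hD, hL⟩ := ih
    exact ⟨D, hD, hL.iso e⟩

/-! ### From labels to fibers. -/

/-- A graph whose vertices fall into fibers of `idx`, each consisting either of one vertex or of two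
wings and a hub, as in a stretched clique all of whose stretched indices are joined by a
single edge. -/
structure IsStretchedCliqueGraph {V ι : Type*} (G : SimpleGraph V) (idx : V → ι)
    (H : Finset V) : Prop where
  adj_hub : ∀ h ∈ H, ∀ w, G.Adj h w ↔ idx w = idx h ∧ w ∉ H
  not_adj : ∀ u w, u ∉ H → w ∉ H → idx u = idx w → ¬ G.Adj u w
  cross : ∀ i j, i ≠ j → ∃ u w, u ∉ H ∧ w ∉ H ∧ idx u = i ∧ idx w = j ∧ G.Adj u w
  fiber : ∀ i, (∃ u ∉ H, ∀ v, idx v = i ↔ v = u) ∨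
    ∃ h ∈ H, ∃ u ∉ H, ∃ w ∉ H, u ≠ w ∧ ∀ v, idx v = i ↔ v = h ∨ v = u ∨ v = w
  exchange : ∀ u u' w w', u ∉ H → u' ∉ H → w ∉ H → w' ∉ H → idx u = idx u' → idx w = idx w' →
    idx u ≠ idx w → G.Adj u w → G.Adj u' w' → G.Adj u w'

/-- The single-edge condition enters only through `exchange`. If one of the four vertices is
unstretched, it is the only vertex of its fiber and the claim is trivial; otherwise both edges are
the same one. -/
theorem IsStretchedLabelling.isStretchedCliqueGraph {n : ℕ} {D : Set (Fin n)} {V : Type*}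
    {G : SimpleGraph V} {label : V → CliqueLabel n} (h : IsStretchedLabelling D G label)
    (H : Finset V) (hH : ∀ v, v ∈ H ↔ (label v).IsHub)
    (hat : ∀ i ∈ stretchedIndices label, ∀ j ∈ stretchedIndices label, i ≠ j →
      {e ∈ G.edgeSet | ∃ u w : V, ∃ a b : Fin 3, a ≠ 0 ∧ b ≠ 0 ∧
        label u = .stretched i a ∧ label w = .stretched j b ∧ e = s(u, w)}.ncard = 1) :
    IsStretchedCliqueGraph G (fun v => (label v).idx) H where
  adj_hub u hu w := by
    rw [hH] at hu ⊢
    exact h.adj_hub u w hu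
  not_adj u w hu hw := by
    rw [hH] at hu hw
    exact h.not_adj u w hu hw
  cross i j hij := by
    simp only [hH]
    exact h.cross i j hij
  fiber i := by
    simp only [hH]
    by_cases hi : i ∈ D
    · right
      obtain ⟨a, ha⟩ := (h.stretched_iff i 0).2 hi
      obtain ⟨b, hb⟩ := (h.stretched_iff i 1).2 hi
      obtain ⟨c, hc⟩ := (h.stretched_iff i 2).2 hi
      refine ⟨a, ?_, b, ?_, c, ?_, ?_, fun v => ⟨fun hv => ?_, ?_⟩⟩
      · simp [ha, CliqueLabel.IsHub]
      · simp [hb, CliqueLabel.IsHub]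
      · simp [hc, CliqueLabel.IsHub]
      · rintro rfl
        rw [hb] at hc
        simp at hc
      · rcases hl : label v with k | ⟨k, j⟩
        · rw [hl] at hv
          obtain rfl : k = i := hv
          exact absurd hi ((h.unstretched_iff k).1 ⟨v, hl⟩)
        · rw [hl] at hv
          obtain rfl : k = i := hv
          fin_cases j
          · exact Or.inl (h.injective (hl.trans ha.symm))
          · exact Or.inr (Or.inl (h.injective (hl.trans hb.symm)))
          · exact Or.inr (Or.inr (h.injective (hl.trans hc.symm)))
      · rintro (rfl | rfl | rfl) <;> simp only [ha, hb, hc, CliqueLabel.idx]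
    · left
      obtain ⟨u, hu⟩ := (h.unstretched_iff i).2 hi
      refine ⟨u, by simp [hu, CliqueLabel.IsHub], fun v => ⟨h.eq_of_idx_eq hu, ?_⟩⟩
      rintro rfl
      rw [hu, CliqueLabel.idx]
  exchange u u' w w' hu hu' hw hw' huu hww huw hadj hadj' := by
    rw [hH] at hu hu' hw hw'
    rcases hlu : label u with i | ⟨i, a⟩
    · have : u' = u := h.eq_of_idx_eq hlu (by rw [← huu, hlu, CliqueLabel.idx])
      rwa [← this]
    rcases hlu' : label u' with i' | ⟨i', a'⟩
    · have : u = u' := h.eq_of_idx_eq hlu' (by rw [huu, hlu', CliqueLabel.idx])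
      rwa [this]
    rcases hlw : label w with j | ⟨j, b⟩
    · have : w' = w := h.eq_of_idx_eq hlw (by rw [← hww, hlw, CliqueLabel.idx])
      rwa [this]
    rcases hlw' : label w' with j' | ⟨j', b'⟩
    · have : w = w' := h.eq_of_idx_eq hlw' (by rw [hww, hlw', CliqueLabel.idx])
      rwa [← this]
    rw [hlu] at hu huu huw
    rw [hlu'] at hu' huu
    rw [hlw] at hw hww huw
    rw [hlw'] at hw' hww
    simp only [CliqueLabel.idx, CliqueLabel.IsHub] at *
    subst huu hww
    obtain ⟨e, he⟩ := Set.ncard_eq_one.1 (hat i ⟨u, a, hlu⟩ j ⟨w, b, hlw⟩ huw)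
    have h1 : s(u, w) = e := by
      rw [← Set.mem_singleton_iff, ← he]
      exact ⟨hadj, u, w, a, b, hu, hw, hlu, hlw, rfl⟩
    have h2 : s(u', w') = e := by
      rw [← Set.mem_singleton_iff, ← he]
      exact ⟨hadj', u', w', a', b', hu', hw', hlu', hlw', rfl⟩
    rcases Sym2.eq_iff.1 (h1.trans h2.symm) with ⟨rfl, rfl⟩ | ⟨rfl, rfl⟩
    · exact hadj
    · rw [hlu] at hlw'
      simp only [CliqueLabel.stretched.injEq] at hlw'
      exact absurd hlw'.1 huw

theorem IsStretchedLabelling.card_hubs {n : ℕ} {D : Set (Fin n)} {V : Type*}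
    {G : SimpleGraph V} {label : V → CliqueLabel n} (h : IsStretchedLabelling D G label)
    (H : Finset V) (hH : ∀ v, v ∈ H ↔ (label v).IsHub) : H.card = D.ncard := by
  have hhub : ∀ v, (label v).IsHub ↔ ∃ i, label v = .stretched i 0 := by
    intro v
    rcases label v with i | ⟨i, j⟩ <;> simp [CliqueLabel.IsHub]
  rw [← Set.ncard_coe_finset]
  refine Set.ncard_congr (fun v _ => (label v).idx) (fun v hv => ?_) (fun u w hu hw huw => ?_)
    (fun i hi => ?_)
  · obtain ⟨i, hi⟩ := (hhub v).1 ((hH v).1 hv)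
    rw [hi]
    exact (h.stretched_iff i 0).1 ⟨v, hi⟩
  · obtain ⟨i, hi⟩ := (hhub u).1 ((hH u).1 hu)
    obtain ⟨j, hj⟩ := (hhub w).1 ((hH w).1 hw)
    rw [hi, hj] at huw
    obtain rfl : i = j := huw
    exact h.injective (hi.trans hj.symm)
  · obtain ⟨v, hv⟩ := (h.stretched_iff i 0).2 hi
    exact ⟨v, (hH v).2 ((hhub v).2 ⟨i, hv⟩), by rw [hv, CliqueLabel.idx]⟩

/-! ### Maximum stable sets, pivots, stability and clique numbers. -/

section StretchedCliqueGraph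

open scoped Classical

variable {V ι : Type*} [Fintype V]

/-- The vertex set that consists of all non-hubs of index `i` and all hubs of the other indices. -/
noncomputable def onSet (idx : V → ι) (H : Finset V) (i : ι) : Finset V :=
  Finset.univ.filter fun u => u ∈ H ↔ idx u ≠ i

theorem mem_onSet {idx : V → ι} {H : Finset V} {i : ι} {u : V} :
    u ∈ onSet idx H i ↔ (u ∈ H ↔ idx u ≠ i) := by
  simp [onSet]

/-- The stable sets of one more element than there are hubs that agree with the set of hubs at all
indices outside `I`. -/
noncomputable def maxStableSets (G : SimpleGraph V) (idx : V → ι) (H : Finset V) (I : Finset ι) :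
    Finset (Finset V) :=
  Finset.univ.filter fun S =>
    G.IsIndepSet (S : Set V) ∧ S.card = H.card + 1 ∧ ∀ u, idx u ∉ I → (u ∈ S ↔ u ∈ H)

theorem mem_maxStableSets {G : SimpleGraph V} {idx : V → ι} {H : Finset V} {I : Finset ι}
    {S : Finset V} : S ∈ maxStableSets G idx H I ↔
      G.IsIndepSet (S : Set V) ∧ S.card = H.card + 1 ∧ ∀ u, idx u ∉ I → (u ∈ S ↔ u ∈ H) := by
  simp [maxStableSets]

/-- A stretched index with hub `j₀` and wings `j₁`, `j₂`, and indices `a`, `b` such that `j₁`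
(resp. `j₂`) is not adjacent to any non-hub of index `a` (resp. `b`). -/
structure IsPivot (G : SimpleGraph V) (idx : V → ι) (H : Finset V) (I : Finset ι)
    (j₀ j₁ j₂ : V) (a b : ι) : Prop where
  hub : j₀ ∈ H
  wing₁ : j₁ ∉ H
  wing₂ : j₂ ∉ H
  wing_ne : j₁ ≠ j₂
  fiber : ∀ v, idx v = idx j₀ ↔ v = j₀ ∨ v = j₁ ∨ v = j₂
  idx_mem : idx j₀ ∈ I
  left_mem : a ∈ I
  right_mem : b ∈ I
  left_ne : a ≠ idx j₀
  right_ne : b ≠ idx j₀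
  left_ne_right : a ≠ b
  not_adj₁ : ∀ u, u ∉ H → idx u = a → ¬ G.Adj j₁ u
  not_adj₂ : ∀ u, u ∉ H → idx u = b → ¬ G.Adj j₂ u

omit [Fintype V] in
theorem IsPivot.symm {G : SimpleGraph V} {idx : V → ι} {H : Finset V} {I : Finset ι}
    {j₀ j₁ j₂ : V} {a b : ι} (P : IsPivot G idx H I j₀ j₁ j₂ a b) :
    IsPivot G idx H I j₀ j₂ j₁ b a :=
  ⟨P.hub, P.wing₂, P.wing₁, P.wing_ne.symm, fun v => by rw [P.fiber v, or_comm (a := v = j₁)],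
    P.idx_mem, P.right_mem, P.left_mem, P.right_ne, P.left_ne, P.left_ne_right.symm, P.not_adj₂,
    P.not_adj₁⟩

omit [Fintype V] in
theorem IsPivot.idx_wing₁ {G : SimpleGraph V} {idx : V → ι} {H : Finset V} {I : Finset ι}
    {j₀ j₁ j₂ : V} {a b : ι} (P : IsPivot G idx H I j₀ j₁ j₂ a b) : idx j₁ = idx j₀ :=
  (P.fiber j₁).2 (Or.inr (Or.inl rfl))

omit [Fintype V] in
theorem IsPivot.idx_wing₂ {G : SimpleGraph V} {idx : V → ι} {H : Finset V} {I : Finset ι}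
    {j₀ j₁ j₂ : V} {a b : ι} (P : IsPivot G idx H I j₀ j₁ j₂ a b) : idx j₂ = idx j₀ :=
  P.symm.idx_wing₁

namespace IsStretchedCliqueGraph

variable {G : SimpleGraph V} {idx : V → ι} {H : Finset V} (h : IsStretchedCliqueGraph G idx H)
include h

omit [Fintype V] in
theorem isIndepSet {S : Finset V} (h₁ : ∀ u ∈ S, ∀ w ∈ S, u ∈ H → w ∉ H → idx w ≠ idx u)
    (h₂ : ∀ u ∈ S, ∀ w ∈ S, u ∉ H → w ∉ H → idx u ≠ idx w → ¬ G.Adj u w) :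
    G.IsIndepSet (S : Set V) := by
  intro u hu w hw _ huw
  by_cases hu' : u ∈ H
  · obtain ⟨h3, h4⟩ := (h.adj_hub u hu' w).1 huw
    exact h₁ u hu w hw hu' h4 h3
  by_cases hw' : w ∈ H
  · obtain ⟨h3, h4⟩ := (h.adj_hub w hw' u).1 huw.symm
    exact h₁ w hw u hu hw' h4 h3
  by_cases hi : idx u = idx w
  · exact h.not_adj u w hu' hw' hi huw
  · exact h₂ u hu w hw hu' hw' hi huw

omit [Fintype V] in
theorem hub_unique {u v : V} (hu : u ∈ H) (hv : v ∈ H) (huv : idx u = idx v) : u = v := by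
  rcases h.fiber (idx v) with ⟨x, hx, hf⟩ | ⟨y, hy, x, hx, w, hw, -, hf⟩
  · rw [(hf v).1 rfl] at hv
    exact absurd hv hx
  · have key : ∀ z ∈ H, idx z = idx v → z = y := by
      intro z hz hzv
      rcases (hf z).1 hzv with rfl | rfl | rfl
      · rfl
      · exact absurd hz hx
      · exact absurd hz hw
    rw [key u hu huv, key v hv rfl]

omit [Fintype V] in
theorem isIndepSet_hubs : G.IsIndepSet (H : Set V) :=
  h.isIndepSet (fun _ _ _ hw _ hw' => absurd hw hw') (fun _ hu _ _ hu' => absurd hu hu')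

theorem isIndepSet_onSet (i : ι) : G.IsIndepSet (onSet idx H i : Set V) := by
  refine h.isIndepSet (fun u hu w hw hu' hw' => ?_) (fun u hu w hw hu' hw' huw => ?_)
  · rw [mem_onSet] at hu hw
    intro hwu
    rw [hwu] at hw
    tauto
  · rw [mem_onSet] at hu hw
    have h1 : idx u = i := by tauto
    have h2 : idx w = i := by tauto
    exact absurd (h1.trans h2.symm) huw

/-- Fiber `i` either gains its only vertex or trades its hub for two wings. -/
theorem card_onSet (i : ι) : (onSet idx H i).card = H.card + 1 := by
  rcases h.fiber i with ⟨u, hu, hf⟩ | ⟨y, hy, u, hu, w, hw, huw, hf⟩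
  · have : onSet idx H i = insert u H := by
      ext v
      rw [mem_onSet, Finset.mem_insert, ne_eq, hf v]
      by_cases hv : v = u
      · simp [hv, hu]
      · simp [hv]
    rw [this, Finset.card_insert_of_notMem hu]
  · have hyi : idx y = i := (hf y).2 (Or.inl rfl)
    have : onSet idx H i = insert u (insert w (H.erase y)) := by
      ext v
      rw [mem_onSet, Finset.mem_insert, Finset.mem_insert, Finset.mem_erase, ne_eq, hf v]
      by_cases hv : v = u
      · simp [hv, hu]
      · by_cases hv' : v = w
        · simp [hv', hw]
        · by_cases hvy : v = y
          · subst hvy; simp [hv, hv', hy]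
          · simp [hv, hv', hvy]
    have h1 := Finset.card_erase_add_one hy
    rw [this, Finset.card_insert_of_notMem (by simp [hu, huw]),
      Finset.card_insert_of_notMem (by simp [hw]), h1]

theorem onSet_mem_maxStableSets {I : Finset ι} {i : ι} (hi : i ∈ I) :
    onSet idx H i ∈ maxStableSets G idx H I := by
  refine mem_maxStableSets.2 ⟨h.isIndepSet_onSet i, h.card_onSet i, fun u hu => ?_⟩
  rw [mem_onSet]
  have : idx u ≠ i := fun hui => hu (hui ▸ hi)
  tauto

/-- A hub in a stable set excludes its wings, so the set agrees with `H` on the whole fiber. This is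
what turns columns of the certificate into instances of the induction hypothesis. -/
theorem filter_hub_mem {I : Finset ι} {u : V} (hu : u ∈ H) :
    (maxStableSets G idx H I).filter (u ∈ ·) = maxStableSets G idx H (I.erase (idx u)) := by
  ext S
  simp only [Finset.mem_filter, mem_maxStableSets, Finset.mem_erase, not_and, and_assoc]
  refine and_congr_right fun hS => and_congr_right fun _ => ⟨fun ⟨h1, h2⟩ v hv => ?_,
    fun h1 => ⟨fun v hv => h1 v fun _ => hv, (h1 u fun hne => absurd rfl hne).2 hu⟩⟩
  by_cases hvu : idx v = idx u
  · by_cases hvH : v ∈ H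
    · rw [h.hub_unique hvH hu hvu]
      simp [h2, hu]
    · have hadj : G.Adj u v := (h.adj_hub u hu v).2 ⟨hvu, hvH⟩
      have : v ∉ S := fun hvS => hS h2 hvS hadj.ne hadj
      tauto
  · exact h1 v (hv hvu)

omit h in
theorem subset_filter_notMem {I : Finset ι} {u : V} (hu : u ∉ H) :
    maxStableSets G idx H (I.erase (idx u)) ⊆ (maxStableSets G idx H I).filter (u ∉ ·) := by
  intro S hS
  rw [mem_maxStableSets] at hS
  rw [Finset.mem_filter, mem_maxStableSets]
  refine ⟨⟨hS.1, hS.2.1, fun v hv => hS.2.2 v fun hv' => hv (Finset.mem_of_mem_erase hv')⟩, ?_⟩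
  rw [hS.2.2 u (by simp)]
  exact hu

omit [Fintype V] in
theorem isIndepSet_insert_hubs {j₀ j₁ : V} (hj₁ : j₁ ∉ H)
    (hidx : ∀ v ∈ H, idx v = idx j₁ → v = j₀) :
    G.IsIndepSet (insert j₁ (H.erase j₀) : Finset V) := by
  refine h.isIndepSet (fun u hu w hw hu' hw' hwu => ?_) (fun u hu w hw hu' hw' huw => ?_)
  · rw [Finset.mem_insert, Finset.mem_erase] at hu hw
    have hw1 : w = j₁ := by tauto
    have hu1 : u ≠ j₁ := fun hu1 => hj₁ (hu1 ▸ hu')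
    have := hidx u hu' (by rw [← hwu, hw1])
    tauto
  · rw [Finset.mem_insert, Finset.mem_erase] at hu hw
    have h1 : u = j₁ := by tauto
    have h2 : w = j₁ := by tauto
    rw [h1, h2] at huw
    exact absurd rfl huw

section Pivot

variable {I : Finset ι} {j₀ j₁ j₂ : V} {a b : ι} (P : IsPivot G idx H I j₀ j₁ j₂ a b)
include P

/-- The non-hubs of `onSet idx H a` are exactly those of fiber `a`, none of which is adjacent to
`j₁`; so `j₁` may replace its hub. -/
theorem swap_mem_maxStableSets :
    insert j₁ ((onSet idx H a).erase j₀) ∈ maxStableSets G idx H I := by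
  have h0 : j₀ ∈ onSet idx H a := by
    rw [mem_onSet]
    exact ⟨fun _ => P.left_ne.symm, fun _ => P.hub⟩
  have h1 : j₁ ∉ onSet idx H a := by
    rw [mem_onSet, P.idx_wing₁]
    have := P.left_ne.symm
    have := P.wing₁
    tauto
  refine mem_maxStableSets.2 ⟨h.isIndepSet (fun u hu w hw hu' hw' hwu => ?_)
    (fun u hu w hw hu' hw' huw => ?_), ?_, fun u hu => ?_⟩
  · rw [Finset.mem_insert, Finset.mem_erase, mem_onSet] at hu hw
    have hu1 : u ≠ j₁ := fun hu1 => P.wing₁ (hu1 ▸ hu')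
    rcases hw with rfl | hw
    · rw [P.idx_wing₁] at hwu
      have := h.hub_unique hu' P.hub hwu.symm
      tauto
    · rw [hwu] at hw
      tauto
  · rw [Finset.mem_insert, Finset.mem_erase, mem_onSet] at hu hw
    rcases hu with rfl | hu <;> rcases hw with rfl | hw
    · exact absurd rfl huw
    · exact P.not_adj₁ w hw' (by tauto)
    · exact fun hadj => P.not_adj₁ u hu' (by tauto) hadj.symm
    · exact absurd (show idx u = idx w by
        rw [show idx u = a by tauto, show idx w = a by tauto]) huw
  · rw [Finset.card_insert_of_notMem (by simp [h1]), Finset.card_erase_add_one h0, h.card_onSet]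
  · have hu1 : u ≠ j₁ := by
      rintro rfl
      exact hu (P.idx_wing₁ ▸ P.idx_mem)
    have hu0 : u ≠ j₀ := by
      rintro rfl
      exact hu P.idx_mem
    have hua : idx u ≠ a := by
      rintro rfl
      exact hu P.left_mem
    rw [Finset.mem_insert, Finset.mem_erase, mem_onSet]
    tauto

omit [Fintype V] in
theorem isIndepSet_insert_wing₁ : G.IsIndepSet (insert j₁ (H.erase j₀) : Finset V) :=
  h.isIndepSet_insert_hubs P.wing₁ fun _ hv hvj => h.hub_unique hv P.hub (hvj.trans P.idx_wing₁)

end Pivot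

/-- If no clique meets all fibers of `I`, then `I` contains a pivot. -/
theorem exists_isPivot {I : Finset ι}
    (hI : ∀ s : Finset V, G.IsClique (s : Set V) → (∀ u ∈ s, idx u ∈ I) → s.card < I.card) :
    ∃ j₀ j₁ j₂ a b, IsPivot G idx H I j₀ j₁ j₂ a b := by
  -- If every fiber of `I` has a non-hub with neighbours in all other fibers of `I`, then `exchange`
  -- makes these representatives pairwise adjacent, which gives a forbidden clique of `I.card`
  -- vertices.
  by_cases hfull : ∀ j ∈ I, ∃ u ∉ H, idx u = j ∧
      ∀ i ∈ I, i ≠ j → ∃ w ∉ H, idx w = i ∧ G.Adj u w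
  · exfalso
    obtain ⟨i₀, hi₀⟩ := Finset.card_pos.1 ((Nat.zero_le _).trans_lt (hI ∅ (by simp) (by simp)))
    obtain ⟨u₀, -⟩ := hfull i₀ hi₀
    have : Nonempty V := ⟨u₀⟩
    choose! f hfH hfi hf using hfull
    have hinj : Set.InjOn f I := fun i hi j hj hij => by rw [← hfi i hi, ← hfi j hj, hij]
    have := hI (I.image f) ?_ ?_
    · rw [Finset.card_image_of_injOn hinj] at this
      exact lt_irrefl _ this
    · intro u hu w hw huw
      simp only [Finset.coe_image, Set.mem_image, Finset.mem_coe] at hu hw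
      obtain ⟨i, hi, rfl⟩ := hu
      obtain ⟨j, hj, rfl⟩ := hw
      have hij : i ≠ j := fun hij => huw (hij ▸ rfl)
      obtain ⟨w, hw, hwj, hiw⟩ := hf i hi j hj hij.symm
      obtain ⟨u, hu, hui, hju⟩ := hf j hj i hi hij
      refine h.exchange (f i) u w (f j) (hfH i hi) hu hw (hfH j hj) ?_ ?_ ?_ hiw hju.symm
      · rw [hfi i hi, hui]
      · rw [hfi j hj, hwj]
      · rwa [hfi i hi, hwj]
    · intro u hu
      obtain ⟨i, hi, rfl⟩ := Finset.mem_image.1 hu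
      rwa [hfi i hi]
  · push Not at hfull
    obtain ⟨j, hj, hfull⟩ := hfull
    rcases h.fiber j with ⟨u, hu, hf⟩ | ⟨y, hy, u, hu, w, hw, huw, hf⟩
    · exfalso
      obtain ⟨i, hi, hij, hadj⟩ := hfull u hu ((hf u).2 rfl)
      obtain ⟨x, z, hx, hz, hxj, hzi, hxz⟩ := h.cross j i hij.symm
      rw [hf x] at hxj
      exact hadj z hz hzi (hxj ▸ hxz)
    · obtain rfl := (hf y).2 (Or.inl rfl)
      have huj := (hf u).2 (Or.inr (Or.inl rfl))
      have hwj := (hf w).2 (Or.inr (Or.inr rfl))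
      obtain ⟨a, ha, haj, hadj⟩ := hfull u hu huj
      obtain ⟨b, hb, hbj, hbdj⟩ := hfull w hw hwj
      refine ⟨y, u, w, a, b, hy, hu, hw, huw, hf, hj, ha, hb, haj, hbj, ?_, hadj, hbdj⟩
      -- With `a = b` neither wing would have a neighbour among the non-hubs of fiber `a`, contrary
      -- to `cross`.
      rintro rfl
      obtain ⟨x, z, hx, hz, hxj, hza, hxz⟩ := h.cross _ _ haj.symm
      rcases (hf x).1 hxj with rfl | rfl | rfl
      · exact hx hy
      · exact hadj z hz hza hxz
      · exact hbdj z hz hza hxz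

/-- Count by fibers: `S` exceeds `H` in a fiber only if it contains all non-hubs there, and then by
just one. By `cross` this happens in at most one fiber. -/
theorem card_le_of_isIndepSet [Fintype ι] {S : Finset V} (hS : G.IsIndepSet (S : Set V)) :
    S.card ≤ H.card + 1 := by
  let on : Finset ι := Finset.univ.filter fun i => ∀ u, u ∉ H → idx u = i → u ∈ S
  have hon : on.card ≤ 1 := by
    rw [Finset.card_le_one]
    intro i hi j hj
    by_contra hij
    simp only [on, Finset.mem_filter, Finset.mem_univ, true_and] at hi hj
    obtain ⟨u, w, hu, hw, hui, hwj, huw⟩ := h.cross i j hij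
    exact hS (hi u hu hui) (hj w hw hwj) huw.ne huw
  have hfib : ∀ i, (S.filter fun u => idx u = i).card ≤
      (H.filter fun u => idx u = i).card + if i ∈ on then 1 else 0 := by
    intro i
    rcases h.fiber i with ⟨u, hu, hf⟩ | ⟨y, hy, u, hu, w, hw, huw, hf⟩
    · have hmem : i ∈ on ↔ u ∈ S := by
        simp only [on, Finset.mem_filter, Finset.mem_univ, true_and]
        exact ⟨fun hi => hi u hu ((hf u).2 rfl), fun hi v _ hvi => (hf v).1 hvi ▸ hi⟩
      refine le_add_left ?_
      split_ifs with hi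
      · refine (Finset.card_le_card (t := {u}) fun v hv => ?_).trans (by simp)
        rw [Finset.mem_filter, hf] at hv
        simp [hv.2]
      · rw [Nat.le_zero, Finset.card_eq_zero, Finset.filter_eq_empty_iff]
        intro v hv hvi
        rw [hf] at hvi
        exact hi (hmem.2 (hvi ▸ hv))
    · have hH : (H.filter fun u => idx u = i) = {y} := by
        ext v
        rw [Finset.mem_filter, hf, Finset.mem_singleton]
        constructor
        · rintro ⟨hv, rfl | rfl | rfl⟩
          · rfl
          · exact absurd hv hu
          · exact absurd hv hw
        · rintro rfl
          exact ⟨hy, Or.inl rfl⟩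
      rw [hH, Finset.card_singleton]
      have hyi := (hf y).2 (Or.inl rfl)
      have hui := (hf u).2 (Or.inr (Or.inl rfl))
      have hwi := (hf w).2 (Or.inr (Or.inr rfl))
      have hyu : G.Adj y u := (h.adj_hub y hy u).2 ⟨hui.trans hyi.symm, hu⟩
      have hyw : G.Adj y w := (h.adj_hub y hy w).2 ⟨hwi.trans hyi.symm, hw⟩
      by_cases hyS : y ∈ S
      · refine le_add_right (Finset.card_le_one.2 ?_)
        have key : ∀ v ∈ S.filter (fun u => idx u = i), v = y := by
          intro v hv
          rw [Finset.mem_filter, hf] at hv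
          obtain ⟨hv, rfl | rfl | rfl⟩ := hv
          · rfl
          · exact absurd hyu (hS hyS hv hyu.ne)
          · exact absurd hyw (hS hyS hv hyw.ne)
        intro v hv v' hv'
        rw [key v hv, key v' hv']
      · split_ifs with hi
        · refine (Finset.card_le_card (t := {u, w}) fun v hv => ?_).trans Finset.card_le_two
          rw [Finset.mem_filter, hf] at hv
          obtain ⟨hv, rfl | hv'⟩ := hv
          · exact absurd hv hyS
          · simpa using hv'
        · have : ∃ x, x ∉ S ∧ (x = u ∨ x = w) := by
            by_contra hx
            push Not at hx
            apply hi
            simp only [on, Finset.mem_filter, Finset.mem_univ, true_and]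
            intro v hv hvi
            rcases (hf v).1 hvi with rfl | rfl | rfl
            · exact absurd hy hv
            · by_contra hvS
              exact (hx v hvS).1 rfl
            · by_contra hvS
              exact (hx v hvS).2 rfl
          obtain ⟨x, hxS, hx⟩ := this
          rw [add_zero, Finset.card_le_one]
          intro v hv v' hv'
          rw [Finset.mem_filter, hf] at hv hv'
          have hvy : v ≠ y := fun hvy => hyS (hvy ▸ hv.1)
          have hvy' : v' ≠ y := fun hvy => hyS (hvy ▸ hv'.1)
          have hvx : v ≠ x := fun hvy => hxS (hvy ▸ hv.1)
          have hvx' : v' ≠ x := fun hvy => hxS (hvy ▸ hv'.1)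
          rcases hx with rfl | rfl
          · rw [show v = w by tauto, show v' = w by tauto]
          · rw [show v = u by tauto, show v' = u by tauto]
  rw [Finset.card_eq_sum_card_fiberwise (f := idx) (s := S) (t := Finset.univ) (by simp),
    Finset.card_eq_sum_card_fiberwise (f := idx) (s := H) (t := Finset.univ) (by simp)]
  refine (Finset.sum_le_sum fun i _ => hfib i).trans ?_
  rw [Finset.sum_add_distrib]
  simpa using hon

theorem indepNum_eq [Fintype ι] [Nonempty ι] : G.indepNum = H.card + 1 := by
  obtain ⟨i⟩ := ‹Nonempty ι›
  refine le_antisymm ?_ ?_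
  · obtain ⟨s, hs⟩ := G.exists_isNIndepSet_indepNum
    rw [← hs.card_eq]
    exact h.card_le_of_isIndepSet hs.isIndepSet
  · rw [← h.card_onSet i]
    exact SimpleGraph.IsIndepSet.card_le_indepNum (h.isIndepSet_onSet i)

-- A clique without hubs meets each fiber at most once. A clique with a hub has at most one further
-- vertex, a wing of that hub; hence the lower bound on the number of indices.
omit [Fintype V] in
theorem cliqueNum_le [Fintype ι] (hι : 2 ≤ Fintype.card ι) : G.cliqueNum ≤ Fintype.card ι := by
  obtain ⟨s, hs⟩ := G.exists_isNClique_cliqueNum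
  rw [← hs.card_eq]
  have hc := hs.isClique
  have hnonhub : ∀ u ∈ s, ∀ w ∈ s, u ∉ H → w ∉ H → idx u = idx w → u = w := by
    intro u hu w hw hu' hw' huw
    by_contra hne
    exact h.not_adj u w hu' hw' huw (hc hu hw hne)
  by_cases hH : ∃ y ∈ s, y ∈ H
  · obtain ⟨y, hy, hyH⟩ := hH
    have herase : (s.erase y).card ≤ 1 := by
      rw [Finset.card_le_one]
      intro u hu w hw
      rw [Finset.mem_erase] at hu hw
      obtain ⟨h1, h2⟩ := (h.adj_hub y hyH u).1 (hc hy hu.2 hu.1.symm)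
      obtain ⟨h3, h4⟩ := (h.adj_hub y hyH w).1 (hc hy hw.2 hw.1.symm)
      exact hnonhub u hu.2 w hw.2 h2 h4 (h1.trans h3.symm)
    have := Finset.card_erase_add_one hy
    omega
  · push Not at hH
    have hinj : Set.InjOn idx s := fun u hu w hw => hnonhub u hu w hw (hH u hu) (hH w hw)
    rw [← Finset.card_image_of_injOn hinj]
    exact Finset.card_le_univ _

end IsStretchedCliqueGraph

end StretchedCliqueGraph

/-! ### Positive semidefiniteness of the certificate. -/

open Matrix in
/-- The correction term in the certificate matrix. -/
def pivotMatrix {κ : Type*} (X A B C A' B' : κ → ℝ) : Matrix κ κ ℝ :=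
  vecMulVec (A - X) (A - A') + vecMulVec (A - A') (A - X) +
    vecMulVec (B - X) (B - B') + vecMulVec (B - B') (B - X) +
    vecMulVec (C - X - B' + B) (C - X - A' + A) + vecMulVec (C - X - A' + A) (C - X - B' + B)

theorem pivotMatrix_col {κ : Type*} (X A B C A' B' : κ → ℝ) (o : κ) :
    (pivotMatrix X A B C A' B').col o =
      (A - A') o • (A - X) + (A - X) o • (A - A') + (B - B') o • (B - X) + (B - X) o • (B - B') +
        (C - X - A' + A) o • (C - X - B' + B) + (C - X - B' + B) o • (C - X - A' + A) := by
  funext p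
  simp [pivotMatrix, Matrix.vecMulVec_apply]
  ring

theorem pivotMatrix_symm {κ : Type*} (X A B C A' B' : κ → ℝ) :
    pivotMatrix X B A C B' A' = pivotMatrix X A B C A' B' := by
  unfold pivotMatrix
  abel

/-- The bracket contributes `+2 X²`, so `X²` has total coefficient `+ε`, and the terms in `X`
complete to `(X + 2 (u - x + v - y - z))²`. The remaining form in `x, y, z, u, v` is at most `126 s`
in absolute value, well below the `200 s` provided. -/
theorem pivot_quadratic_nonneg (x y z u v s X ε : ℝ) (h0 : 0 ≤ ε) (h1 : ε ≤ 1 / 200)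
    (hx : x ^ 2 ≤ s) (hy : y ^ 2 ≤ s) (hz : z ^ 2 ≤ s) (hu : u ^ 2 ≤ s) (hv : v ^ 2 ≤ s) :
    0 ≤ s - ε * X ^ 2 + ε * (2 * ((x - X) * (x - u) + (y - X) * (y - v) +
      (z - X - v + y) * (z - X - u + x))) := by
  have key : 0 ≤ 200 * s - X ^ 2 + 2 * ((x - X) * (x - u) + (y - X) * (y - v) +
      (z - X - v + y) * (z - X - u + x)) := by
    nlinarith [sq_nonneg (X + 2 * (u - x + v - y - z)), sq_nonneg (u + x), sq_nonneg (v + y),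
      sq_nonneg (z + x), sq_nonneg (z + y), sq_nonneg (z + u), sq_nonneg (z + v),
      sq_nonneg (z - x), sq_nonneg (z - y), sq_nonneg (z - u), sq_nonneg (z - v),
      sq_nonneg (u - x), sq_nonneg (v - y), sq_nonneg (x - y), sq_nonneg (x + y),
      sq_nonneg (u - v), sq_nonneg (u + v), sq_nonneg (x - v), sq_nonneg (x + v),
      sq_nonneg (u - y), sq_nonneg (u + y)]
  have hs : 0 ≤ s := (sq_nonneg x).trans hx
  nlinarith [mul_nonneg h0 key, mul_nonneg hs (sub_nonneg.2 h1)]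

open Matrix in
theorem posSemidef_pivot {κ σ : Type*} [Fintype κ] (Z : Finset σ) (f : σ → κ → ℝ)
    (X A B C A' B' : κ → ℝ) (hA : ∃ i ∈ Z, f i = A) (hB : ∃ i ∈ Z, f i = B)
    (hC : ∃ i ∈ Z, f i = C) (hA' : ∃ i ∈ Z, f i = A') (hB' : ∃ i ∈ Z, f i = B')
    {ε : ℝ} (h0 : 0 ≤ ε) (h1 : ε ≤ 1 / 200) :
    (∑ i ∈ Z, vecMulVec (f i) (f i) - ε • vecMulVec X X +
      ε • pivotMatrix X A B C A' B').PosSemidef := by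
  refine .of_dotProduct_mulVec_nonneg ?_ fun x => ?_
  · ext p q
    simp only [conjTranspose_apply, star_trivial, Matrix.add_apply, Matrix.sub_apply,
      Matrix.smul_apply, Matrix.sum_apply,
      vecMulVec_apply, pivotMatrix, smul_eq_mul]
    simp only [mul_comm (f _ q) (f _ p)]
    ring
  · have hvec : ∀ a b : κ → ℝ, x ⬝ᵥ (vecMulVec a b *ᵥ x) = (a ⬝ᵥ x) * (b ⬝ᵥ x) := by
      intro a b
      simp [vecMulVec_mulVec, dotProduct_comm, mul_comm]
    have hle : ∀ D : κ → ℝ, (∃ i ∈ Z, f i = D) → (D ⬝ᵥ x) ^ 2 ≤ ∑ i ∈ Z, (f i ⬝ᵥ x) ^ 2 := by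
      rintro D ⟨i, hi, rfl⟩
      exact Finset.single_le_sum (f := fun i => (f i ⬝ᵥ x) ^ 2) (fun _ _ => sq_nonneg _) hi
    have key := pivot_quadratic_nonneg _ _ _ _ _ _ (X ⬝ᵥ x) ε h0 h1 (hle A hA) (hle B hB)
      (hle C hC) (hle A' hA') (hle B' hB')
    refine key.trans_eq ?_
    simp only [star_trivial, add_mulVec, sub_mulVec, smul_mulVec, sum_mulVec, pivotMatrix,
      dotProduct_add, dotProduct_sub, dotProduct_smul, dotProduct_sum, hvec, add_dotProduct,
      sub_dotProduct, smul_eq_mul, pow_two]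
    ring

/-! ### Cone arithmetic with sums of stable sets. -/

/-- The homogenized incidence vector `(1, χ_S)`. -/
noncomputable def homIncidence {V : Type*} (S : Finset V) : Option V → ℝ :=
  homVec (incidence (S : Set V))

@[simp]
theorem homIncidence_none {V : Type*} (S : Finset V) : homIncidence S none = 1 := rfl

open scoped Classical in
theorem homIncidence_some {V : Type*} (S : Finset V) (v : V) :
    homIncidence S (some v) = if v ∈ S then 1 else 0 := by
  simp [homIncidence, homVec, incidence_apply]

/-- The homogenized cone of a nonempty convex set, as a pointed cone. -/
def homPointedCone {ι : Type*} (P : Set (ι → ℝ)) (hP : Convex ℝ P) (hP' : P.Nonempty) :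
    PointedCone ℝ (Option ι → ℝ) where
  carrier := homCone P
  add_mem' hx hy := homCone_add hP hx hy
  zero_mem' := zero_mem_homCone hP'
  smul_mem' c _ hx := homCone_smul c.2 hx

theorem sum_homIncidence_mem {V : Type*} {K : PointedCone ℝ (Option V → ℝ)}
    {Z : Finset (Finset V)} (hZ : ∀ S ∈ Z, homIncidence S ∈ K) :
    ∑ S ∈ Z, homIncidence S ∈ K :=
  Submodule.sum_mem _ hZ

theorem smul_sum_sub_mem {V : Type*} {K : PointedCone ℝ (Option V → ℝ)}
    {Z : Finset (Finset V)} (hZ : ∀ S ∈ Z, homIncidence S ∈ K) {T : Finset V} (hT : T ∈ Z)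
    {r δ : ℝ} (hr : 0 ≤ r) (hδ : δ ≤ r) :
    r • ∑ S ∈ Z, homIncidence S - δ • homIncidence T ∈ K := by
  classical
  have h1 : r • ∑ S ∈ Z.erase T, homIncidence S + (r - δ) • homIncidence T ∈ K :=
    K.add_mem (K.smul_mem hr (sum_homIncidence_mem fun S hS => hZ S (Finset.mem_of_mem_erase hS)))
      (K.smul_mem (sub_nonneg.2 hδ) (hZ T hT))
  rw [← Finset.add_sum_erase Z _ hT]
  convert h1 using 1
  module

theorem sum_sub_mem {V : Type*} {K : PointedCone ℝ (Option V → ℝ)}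
    {Z : Finset (Finset V)} (hZ : ∀ S ∈ Z, homIncidence S ∈ K) {T : Finset V} (hT : T ∈ Z)
    {δ : ℝ} (hδ : δ ≤ 1) : ∑ S ∈ Z, homIncidence S - δ • homIncidence T ∈ K := by
  have := smul_sum_sub_mem hZ hT zero_le_one hδ
  rwa [one_smul] at this

theorem sum_sub_mem_of_subset {V : Type*} {K : PointedCone ℝ (Option V → ℝ)}
    {Z Z' : Finset (Finset V)} (hZ : ∀ S ∈ Z, homIncidence S ∈ K) (hsub : Z' ⊆ Z)
    {x : Option V → ℝ} (hx : ∑ S ∈ Z', homIncidence S - x ∈ K) :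
    ∑ S ∈ Z, homIncidence S - x ∈ K := by
  classical
  have h1 := K.add_mem hx (sum_homIncidence_mem (Z := Z \ Z') fun S hS =>
    hZ S (Finset.sdiff_subset hS))
  rw [← Finset.sum_sdiff hsub]
  convert h1 using 1
  abel

/-- Since `T` lies outside `Z'`, its multiple is paid from the summands of `Z \ Z'`, which the
hypothesis on `x` does not use. -/
theorem sum_sub_sub_mem_of_subset {V : Type*} {K : PointedCone ℝ (Option V → ℝ)}
    {Z Z' : Finset (Finset V)} (hZ : ∀ S ∈ Z, homIncidence S ∈ K) (hsub : Z' ⊆ Z)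
    {x : Option V → ℝ} (hx : ∑ S ∈ Z', homIncidence S - x ∈ K) {T : Finset V} (hT : T ∈ Z)
    (hT' : T ∉ Z') {δ : ℝ} (hδ : δ ≤ 1) :
    ∑ S ∈ Z, homIncidence S - x - δ • homIncidence T ∈ K := by
  classical
  have h1 := K.add_mem hx (sum_sub_mem (Z := Z \ Z') (fun S hS => hZ S (Finset.sdiff_subset hS))
    (Finset.mem_sdiff.2 ⟨hT, hT'⟩) hδ)
  rw [← Finset.sum_sdiff hsub]
  convert h1 using 1
  abel

/-! ### The correction matrix of a pivot and its columns. -/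

section StretchedCliqueGraph

open scoped Classical

variable {V ι : Type*} [Fintype V] {G : SimpleGraph V} {idx : V → ι} {H : Finset V} {I : Finset ι}

section PivotVectors

variable {j₀ j₁ j₂ : V} {a b : ι}

theorem IsPivot.onSet_sub_hubs_apply (i : ι) (u : V) :
    (homIncidence (onSet idx H i) - homIncidence H) (some u) =
      if idx u = i then if u ∈ H then -1 else 1 else 0 := by
  simp only [Pi.sub_apply, homIncidence_some, mem_onSet]
  by_cases hu : u ∈ H <;> by_cases hi : idx u = i <;> simp [hu, hi]

theorem IsPivot.onSet_sub_swap_apply (P : IsPivot G idx H I j₀ j₁ j₂ a b) (u : V) :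
    (homIncidence (onSet idx H a) - homIncidence (insert j₁ ((onSet idx H a).erase j₀))) (some u) =
      (if u = j₀ then 1 else 0) - if u = j₁ then 1 else 0 := by
  have h01 : j₀ ≠ j₁ := fun h => P.wing₁ (h ▸ P.hub)
  simp only [Pi.sub_apply, homIncidence_some, Finset.mem_insert, Finset.mem_erase, mem_onSet]
  by_cases hu0 : u = j₀
  · subst hu0
    simp [h01, P.hub, P.left_ne.symm]
  by_cases hu1 : u = j₁
  · subst hu1
    simp [hu0, P.wing₁, P.idx_wing₁, P.left_ne.symm]
  simp [hu0, hu1]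

/-- Switching the pivot's fiber on adds `e_{j₁} + e_{j₂} - e_{j₀}`, and undoing the swap at `b` adds
`e_{j₀} - e_{j₂}`. Thus the last pair of terms in `pivotMatrix` is just `e_{j₁} e_{j₂}ᵀ` plus its
transpose. -/
theorem IsPivot.wing_apply (P : IsPivot G idx H I j₀ j₁ j₂ a b) (u : V) :
    (homIncidence (onSet idx H (idx j₀)) - homIncidence H -
      homIncidence (insert j₂ ((onSet idx H b).erase j₀)) + homIncidence (onSet idx H b)) (some u) =
      if u = j₁ then 1 else 0 := by
  have h1 := IsPivot.onSet_sub_hubs_apply (idx := idx) (H := H) (idx j₀) u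
  have h2 := P.symm.onSet_sub_swap_apply u
  have h01 : j₀ ≠ j₁ := fun h => P.wing₁ (h ▸ P.hub)
  have h02 : j₀ ≠ j₂ := fun h => P.wing₂ (h ▸ P.hub)
  rw [sub_add, ← neg_sub (homIncidence (onSet idx H b)), sub_neg_eq_add, Pi.add_apply, h1, h2,
    P.fiber]
  by_cases hu0 : u = j₀
  · subst hu0
    simp [h01, h02, P.hub]
  by_cases hu1 : u = j₁
  · subst hu1
    simp [hu0, P.wing₁, P.wing_ne]
  by_cases hu2 : u = j₂
  · subst hu2
    simp [hu0, P.wing₂, P.wing_ne.symm]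
  simp [hu0, hu1, hu2]

/-- A stable set written in terms of the pivot vectors: adding a multiple of it trades the hubs and
the swapped set against `onSet idx H a` in a column. -/
theorem IsPivot.homIncidence_insert_wing₁ (P : IsPivot G idx H I j₀ j₁ j₂ a b) :
    homIncidence (insert j₁ (H.erase j₀)) = homIncidence H +
      homIncidence (insert j₁ ((onSet idx H a).erase j₀)) - homIncidence (onSet idx H a) := by
  funext o
  rcases o with _ | u
  · simp
  · have h1 := P.onSet_sub_swap_apply u
    have h01 : j₀ ≠ j₁ := fun h => P.wing₁ (h ▸ P.hub)
    rw [add_sub_assoc, ← neg_sub, Pi.add_apply, Pi.neg_apply, h1]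
    simp only [homIncidence_some, Finset.mem_insert, Finset.mem_erase]
    by_cases hu0 : u = j₀
    · subst hu0
      simp [h01, P.hub]
    by_cases hu1 : u = j₁
    · subst hu1
      simp [hu0, P.wing₁]
    simp [hu0, hu1]

/-- The analogous relation needed for the columns of the wings; the left side is stable as part of
`onSet idx H b`. -/
theorem IsPivot.homIncidence_onSet_erase (P : IsPivot G idx H I j₀ j₁ j₂ a b) :
    homIncidence ((onSet idx H b).erase j₀) = homIncidence H +
      homIncidence (insert j₁ ((onSet idx H a).erase j₀)) +
      homIncidence (insert j₂ ((onSet idx H b).erase j₀)) - homIncidence (onSet idx H a) -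
      homIncidence (onSet idx H (idx j₀)) := by
  funext o
  rcases o with _ | u
  · simp
  · have h1 := P.onSet_sub_swap_apply u
    have h2 := P.wing_apply u
    have h02 : j₀ ≠ j₂ := fun h => P.wing₂ (h ▸ P.hub)
    simp only [Pi.add_apply, Pi.sub_apply] at h1 h2 ⊢
    have key : homIncidence ((onSet idx H b).erase j₀) (some u) =
        homIncidence (onSet idx H b) (some u) - if u = j₀ then 1 else 0 := by
      simp only [homIncidence_some, Finset.mem_erase, mem_onSet]
      by_cases hu0 : u = j₀
      · subst hu0
        simp [P.hub, P.right_ne.symm]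
      simp [hu0]
    rw [key]
    linarith

/-- The correction term in the certificate matrix that belongs to a pivot. -/
noncomputable def stretchPivotMatrix (idx : V → ι) (H : Finset V) (j₀ j₁ j₂ : V) (a b : ι) :
    Matrix (Option V) (Option V) ℝ :=
  pivotMatrix (homIncidence H) (homIncidence (onSet idx H a)) (homIncidence (onSet idx H b))
    (homIncidence (onSet idx H (idx j₀))) (homIncidence (insert j₁ ((onSet idx H a).erase j₀)))
    (homIncidence (insert j₂ ((onSet idx H b).erase j₀)))

theorem stretchPivotMatrix_symm :
    stretchPivotMatrix idx H j₀ j₂ j₁ b a = stretchPivotMatrix idx H j₀ j₁ j₂ a b :=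
  pivotMatrix_symm ..

theorem stretchPivotMatrix_col_none : (stretchPivotMatrix idx H j₀ j₁ j₂ a b).col none = 0 := by
  rw [stretchPivotMatrix, pivotMatrix_col]
  simp

theorem IsPivot.col_some (P : IsPivot G idx H I j₀ j₁ j₂ a b) (u : V) :
    (stretchPivotMatrix idx H j₀ j₁ j₂ a b).col (some u) =
      ((if u = j₀ then 1 else 0) - if u = j₁ then 1 else 0 : ℝ) •
        (homIncidence (onSet idx H a) - homIncidence H) +
      (if idx u = a then if u ∈ H then -1 else 1 else 0 : ℝ) • (homIncidence (onSet idx H a) -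
        homIncidence (insert j₁ ((onSet idx H a).erase j₀))) +
      ((if u = j₀ then 1 else 0) - if u = j₂ then 1 else 0 : ℝ) •
        (homIncidence (onSet idx H b) - homIncidence H) +
      (if idx u = b then if u ∈ H then -1 else 1 else 0 : ℝ) • (homIncidence (onSet idx H b) -
        homIncidence (insert j₂ ((onSet idx H b).erase j₀))) +
      (if u = j₂ then 1 else 0 : ℝ) • (homIncidence (onSet idx H (idx j₀)) - homIncidence H -
        homIncidence (insert j₂ ((onSet idx H b).erase j₀)) + homIncidence (onSet idx H b)) +
      (if u = j₁ then 1 else 0 : ℝ) • (homIncidence (onSet idx H (idx j₀)) - homIncidence H -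
        homIncidence (insert j₁ ((onSet idx H a).erase j₀)) + homIncidence (onSet idx H a)) := by
  rw [stretchPivotMatrix, pivotMatrix_col, P.onSet_sub_swap_apply, onSet_sub_hubs_apply,
    P.symm.onSet_sub_swap_apply, onSet_sub_hubs_apply, P.wing_apply, P.symm.wing_apply]

theorem IsPivot.col_left (P : IsPivot G idx H I j₀ j₁ j₂ a b) {u : V} (hu : idx u = a) :
    (stretchPivotMatrix idx H j₀ j₁ j₂ a b).col (some u) =
      (if u ∈ H then -1 else 1 : ℝ) • (homIncidence (onSet idx H a) -
        homIncidence (insert j₁ ((onSet idx H a).erase j₀))) := by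
  have h0 : ¬ (u = j₀ ∨ u = j₁ ∨ u = j₂) := by
    rw [← P.fiber u, hu]
    exact P.left_ne
  push Not at h0
  rw [P.col_some]
  simp [h0, hu, P.left_ne_right]

theorem IsPivot.col_other (P : IsPivot G idx H I j₀ j₁ j₂ a b) {u : V} (ha : idx u ≠ a)
    (hb : idx u ≠ b) (hj : idx u ≠ idx j₀) :
    (stretchPivotMatrix idx H j₀ j₁ j₂ a b).col (some u) = 0 := by
  have h0 := hj
  rw [ne_eq, P.fiber u] at h0
  push Not at h0
  rw [P.col_some]
  simp [h0, ha, hb]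

theorem IsPivot.col_hub (P : IsPivot G idx H I j₀ j₁ j₂ a b) :
    (stretchPivotMatrix idx H j₀ j₁ j₂ a b).col (some j₀) =
      homIncidence (onSet idx H a) + homIncidence (onSet idx H b) - (2 : ℝ) • homIncidence H := by
  have h01 : j₀ ≠ j₁ := fun h => P.wing₁ (h ▸ P.hub)
  have h02 : j₀ ≠ j₂ := fun h => P.wing₂ (h ▸ P.hub)
  rw [P.col_some]
  simp only [h01, h02, P.left_ne.symm, P.right_ne.symm, if_true, if_false]
  module

theorem IsPivot.col_wing₁ (P : IsPivot G idx H I j₀ j₁ j₂ a b) :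
    (stretchPivotMatrix idx H j₀ j₁ j₂ a b).col (some j₁) =
      homIncidence (onSet idx H (idx j₀)) -
        homIncidence (insert j₁ ((onSet idx H a).erase j₀)) := by
  have h01 : j₁ ≠ j₀ := fun h => P.wing₁ (h ▸ P.hub)
  rw [P.col_some, P.idx_wing₁]
  simp only [h01, P.wing_ne, P.left_ne.symm, P.right_ne.symm, if_true, if_false]
  module

end PivotVectors

end StretchedCliqueGraph

/-! ### The columns of the certificate lie in the cone. -/

section StretchedCliqueGraph

open scoped Classical

variable {V ι : Type*} [Fintype V] {G : SimpleGraph V} {idx : V → ι} {H : Finset V} {I : Finset ι}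

theorem isIndepSet_of_mem_filter {p : Finset V → Prop} [DecidablePred p] {S : Finset V}
    (hS : S ∈ (maxStableSets G idx H I).filter p) : G.IsIndepSet (S : Set V) :=
  (mem_maxStableSets.1 (Finset.mem_filter.1 hS).1).1

section Columns

variable {K : PointedCone ℝ (Option V → ℝ)}
  (hK : ∀ S : Finset V, G.IsIndepSet (S : Set V) → homIncidence S ∈ K)
  {j₀ j₁ j₂ : V} {a b : ι}

include hK in
-- All sets in the sum agree with `H` at `u`, so one of the two columns is the whole vector.
theorem column_mem_of_notMem {ε : ℝ}
    (hI : ∑ S ∈ maxStableSets G idx H I, homIncidence S - ε • homIncidence H ∈ K)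
    {u : V} (hu : idx u ∉ I) :
    ∑ S ∈ (maxStableSets G idx H I).filter (u ∈ ·), homIncidence S -
      (ε * if u ∈ H then 1 else 0) • homIncidence H ∈ K ∧
    ∑ S ∈ (maxStableSets G idx H I).filter (u ∉ ·), homIncidence S -
      (ε * if u ∈ H then 0 else 1) • homIncidence H ∈ K := by
  by_cases huH : u ∈ H
  · have h1 : (maxStableSets G idx H I).filter (u ∈ ·) = maxStableSets G idx H I :=
      Finset.filter_true_of_mem fun S hS => ((mem_maxStableSets.1 hS).2.2 u hu).2 huH
    rw [h1]
    refine ⟨by simpa [huH] using hI, ?_⟩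
    simpa [huH] using sum_homIncidence_mem fun S hS => hK S (isIndepSet_of_mem_filter hS)
  · have h1 : (maxStableSets G idx H I).filter (u ∉ ·) = maxStableSets G idx H I :=
      Finset.filter_true_of_mem fun S hS h => huH (((mem_maxStableSets.1 hS).2.2 u hu).1 h)
    rw [h1]
    refine ⟨?_, by simpa [huH] using hI⟩
    simpa [huH] using sum_homIncidence_mem fun S hS => hK S (isIndepSet_of_mem_filter hS)

variable (h : IsStretchedCliqueGraph G idx H)
include hK h

theorem IsStretchedCliqueGraph.column_mem_of_mem {ε : ℝ}
    (hrec : ∀ i ∈ I,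
      ∑ S ∈ maxStableSets G idx H (I.erase i), homIncidence S - ε • homIncidence H ∈ K)
    {u : V} (hu : idx u ∈ I) :
    ∑ S ∈ (maxStableSets G idx H I).filter (u ∈ ·), homIncidence S -
      (ε * if u ∈ H then 1 else 0) • homIncidence H ∈ K ∧
    ∑ S ∈ (maxStableSets G idx H I).filter (u ∉ ·), homIncidence S -
      (ε * if u ∈ H then 0 else 1) • homIncidence H ∈ K := by
  by_cases huH : u ∈ H
  · refine ⟨by simpa [huH, h.filter_hub_mem huH] using hrec _ hu, ?_⟩
    simpa [huH] using sum_homIncidence_mem fun S hS => hK S (isIndepSet_of_mem_filter hS)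
  · constructor
    · simpa [huH] using sum_homIncidence_mem fun S hS => hK S (isIndepSet_of_mem_filter hS)
    · simpa [huH] using sum_sub_mem_of_subset (fun S hS => hK S (isIndepSet_of_mem_filter hS))
        (subset_filter_notMem huH) (hrec _ hu)

variable (P : IsPivot G idx H I j₀ j₁ j₂ a b)
include P

theorem IsStretchedCliqueGraph.column_mem_left {ε : ℝ} (h0 : 0 ≤ ε) (h1 : ε ≤ 1 / 2)
    (hrec : ∀ i ∈ I,
      ∑ S ∈ maxStableSets G idx H (I.erase i), homIncidence S - (2 * ε) • homIncidence H ∈ K)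
    {u : V} (hu : idx u = a) :
    ∑ S ∈ (maxStableSets G idx H I).filter (u ∈ ·), homIncidence S -
      (ε * if u ∈ H then 1 else 0) • homIncidence H +
      ε • (stretchPivotMatrix idx H j₀ j₁ j₂ a b).col (some u) ∈ K ∧
    ∑ S ∈ (maxStableSets G idx H I).filter (u ∉ ·), homIncidence S -
      (ε * if u ∈ H then 0 else 1) • homIncidence H -
      ε • (stretchPivotMatrix idx H j₀ j₁ j₂ a b).col (some u) ∈ K := by
  have hE := hK _ (h.isIndepSet_insert_wing₁ P)
  rw [P.homIncidence_insert_wing₁] at hE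
  have hA := hK _ (h.isIndepSet_onSet a)
  have hA' := h.swap_mem_maxStableSets P
  have huI : idx u ∈ I := hu ▸ P.left_mem
  have hu0 : u ≠ j₀ := by
    rintro rfl
    exact P.left_ne hu.symm
  have hu1 : u ≠ j₁ := by
    rintro rfl
    exact P.left_ne (hu ▸ P.idx_wing₁)
  rw [P.col_left hu]
  by_cases huH : u ∈ H
  · constructor
    -- One `ε` is the original term; the second pays for the hubs contained in the stable set
    -- `insert j₁ (H.erase j₀)`.
    · rw [h.filter_hub_mem huH]
      convert K.add_mem (hrec _ huI) (K.smul_mem h0 hE) using 1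
      simp only [huH, if_true]
      module
    · have hmem : insert j₁ ((onSet idx H a).erase j₀) ∈
          (maxStableSets G idx H I).filter (u ∉ ·) := by
        refine Finset.mem_filter.2 ⟨hA', ?_⟩
        rw [Finset.mem_insert, Finset.mem_erase, mem_onSet]
        tauto
      convert K.add_mem (sum_sub_mem (K := K) (δ := ε)
        (fun S hS => hK S (isIndepSet_of_mem_filter hS)) hmem (by linarith))
        (K.smul_mem h0 hA) using 1
      simp only [huH, if_true]
      module
  · constructor
    · have hmem : insert j₁ ((onSet idx H a).erase j₀) ∈
          (maxStableSets G idx H I).filter (u ∈ ·) := by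
        refine Finset.mem_filter.2 ⟨hA', ?_⟩
        rw [Finset.mem_insert, Finset.mem_erase, mem_onSet]
        tauto
      convert K.add_mem (sum_sub_mem (K := K) (δ := ε)
        (fun S hS => hK S (isIndepSet_of_mem_filter hS)) hmem (by linarith))
        (K.smul_mem h0 hA) using 1
      simp only [huH, if_false]
      module
    · convert K.add_mem (sum_sub_mem_of_subset (K := K)
        (fun S hS => hK S (isIndepSet_of_mem_filter hS))
        (subset_filter_notMem huH) (hrec _ huI)) (K.smul_mem h0 hE) using 1
      simp only [huH, if_false]
      module

theorem IsStretchedCliqueGraph.column_mem_hub {ε : ℝ} (h0 : 0 ≤ ε) (h1 : ε ≤ 1 / 2)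
    (hrec : ∀ i ∈ I,
      ∑ S ∈ maxStableSets G idx H (I.erase i), homIncidence S - (3 * ε) • homIncidence H ∈ K) :
    ∑ S ∈ (maxStableSets G idx H I).filter (j₀ ∈ ·), homIncidence S -
      (ε * if j₀ ∈ H then 1 else 0) • homIncidence H +
      ε • (stretchPivotMatrix idx H j₀ j₁ j₂ a b).col (some j₀) ∈ K ∧
    ∑ S ∈ (maxStableSets G idx H I).filter (j₀ ∉ ·), homIncidence S -
      (ε * if j₀ ∈ H then 0 else 1) • homIncidence H -
      ε • (stretchPivotMatrix idx H j₀ j₁ j₂ a b).col (some j₀) ∈ K := by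
  have hE₁ := hK _ (h.isIndepSet_insert_wing₁ P)
  rw [P.homIncidence_insert_wing₁] at hE₁
  have hE₂ := hK _ (h.isIndepSet_insert_wing₁ P.symm)
  rw [P.symm.homIncidence_insert_wing₁] at hE₂
  have h01 : j₀ ≠ j₁ := fun h => P.wing₁ (h ▸ P.hub)
  have h02 : j₀ ≠ j₂ := fun h => P.wing₂ (h ▸ P.hub)
  rw [P.col_hub]
  constructor
  -- The correction subtracts the hubs twice more; this is where the factor `3` arises.
  · rw [h.filter_hub_mem P.hub]
    convert K.add_mem (hrec _ P.idx_mem) (K.add_mem (K.smul_mem h0 (hK _ (h.isIndepSet_onSet a)))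
      (K.smul_mem h0 (hK _ (h.isIndepSet_onSet b)))) using 1
    simp only [P.hub, if_true]
    module
  · have hA' : insert j₁ ((onSet idx H a).erase j₀) ∈
        (maxStableSets G idx H I).filter (j₀ ∉ ·) :=
      Finset.mem_filter.2 ⟨h.swap_mem_maxStableSets P, by simp [h01]⟩
    have hB' : insert j₂ ((onSet idx H b).erase j₀) ∈
        (maxStableSets G idx H I).filter (j₀ ∉ ·) :=
      Finset.mem_filter.2 ⟨h.swap_mem_maxStableSets P.symm, by simp [h02]⟩
    have hS : ∀ S ∈ (maxStableSets G idx H I).filter (j₀ ∉ ·), homIncidence S ∈ K :=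
      fun S hS => hK S (isIndepSet_of_mem_filter hS)
    -- Half of the sum pays for each of the two swapped sets, hence the requirement `ε ≤ 1 / 2`.
    convert K.add_mem (K.add_mem (smul_sum_sub_mem (r := 1 / 2) hS hA' (by norm_num) h1)
      (smul_sum_sub_mem (r := 1 / 2) hS hB' (by norm_num) h1))
      (K.add_mem (K.smul_mem h0 hE₁) (K.smul_mem h0 hE₂)) using 1
    simp only [P.hub, if_true]
    module

theorem IsStretchedCliqueGraph.column_mem_wing₁ {ε : ℝ} (h0 : 0 ≤ ε) (h1 : ε ≤ 1 / 2)
    (hrec : ∀ i ∈ I,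
      ∑ S ∈ maxStableSets G idx H (I.erase i), homIncidence S - (2 * ε) • homIncidence H ∈ K) :
    ∑ S ∈ (maxStableSets G idx H I).filter (j₁ ∈ ·), homIncidence S -
      (ε * if j₁ ∈ H then 1 else 0) • homIncidence H +
      ε • (stretchPivotMatrix idx H j₀ j₁ j₂ a b).col (some j₁) ∈ K ∧
    ∑ S ∈ (maxStableSets G idx H I).filter (j₁ ∉ ·), homIncidence S -
      (ε * if j₁ ∈ H then 0 else 1) • homIncidence H -
      ε • (stretchPivotMatrix idx H j₀ j₁ j₂ a b).col (some j₁) ∈ K := by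
  have hF : homIncidence ((onSet idx H b).erase j₀) ∈ K :=
    hK _ ((h.isIndepSet_onSet b).mono (by simp))
  rw [P.homIncidence_onSet_erase] at hF
  rw [P.col_wing₁]
  constructor
  · have hA' : insert j₁ ((onSet idx H a).erase j₀) ∈
        (maxStableSets G idx H I).filter (j₁ ∈ ·) :=
      Finset.mem_filter.2 ⟨h.swap_mem_maxStableSets P, by simp⟩
    convert K.add_mem (sum_sub_mem (K := K) (δ := ε)
      (fun S hS => hK S (isIndepSet_of_mem_filter hS)) hA' (by linarith))
      (K.smul_mem h0 (hK _ (h.isIndepSet_onSet (idx j₀)))) using 1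
    simp only [P.wing₁, if_false]
    module
  · have hB' : insert j₂ ((onSet idx H b).erase j₀) ∈
        (maxStableSets G idx H I).filter (j₁ ∉ ·) := by
      refine Finset.mem_filter.2 ⟨h.swap_mem_maxStableSets P.symm, ?_⟩
      rw [Finset.mem_insert, Finset.mem_erase, mem_onSet, P.idx_wing₁]
      have := P.wing₁
      have := P.wing_ne
      have := P.right_ne.symm
      tauto
    -- This set contains a wing of the pivot, so its summand is untouched by the induction
    -- hypothesis and can pay for the set subtracted below.
    have hB'' : insert j₂ ((onSet idx H b).erase j₀) ∉
        maxStableSets G idx H (I.erase (idx j₁)) := by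
      rw [mem_maxStableSets]
      intro hm
      exact P.wing₂ ((hm.2.2 j₂ (by simp [P.idx_wing₁, P.idx_wing₂])).1 (by simp))
    have huI : idx j₁ ∈ I := P.idx_wing₁ ▸ P.idx_mem
    convert K.add_mem (sum_sub_sub_mem_of_subset (K := K) (δ := ε)
      (fun S hS => hK S (isIndepSet_of_mem_filter hS)) (subset_filter_notMem P.wing₁)
      (hrec _ huI) hB' hB'' (by linarith)) (K.add_mem (K.smul_mem h0 hF)
      (K.smul_mem h0 (hK _ (h.isIndepSet_onSet a)))) using 1
    simp only [P.wing₁, if_false]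
    module

theorem IsStretchedCliqueGraph.column_mem {ε : ℝ} (h0 : 0 ≤ ε) (h1 : ε ≤ 1 / 2)
    (hI : ∑ S ∈ maxStableSets G idx H I, homIncidence S - ε • homIncidence H ∈ K)
    (hrec : ∀ i ∈ I, ∀ r : ℝ, 1 ≤ r → r ≤ 3 →
      ∑ S ∈ maxStableSets G idx H (I.erase i), homIncidence S - (r * ε) • homIncidence H ∈ K)
    (u : V) :
    ∑ S ∈ (maxStableSets G idx H I).filter (u ∈ ·), homIncidence S -
      (ε * if u ∈ H then 1 else 0) • homIncidence H +
      ε • (stretchPivotMatrix idx H j₀ j₁ j₂ a b).col (some u) ∈ K ∧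
    ∑ S ∈ (maxStableSets G idx H I).filter (u ∉ ·), homIncidence S -
      (ε * if u ∈ H then 0 else 1) • homIncidence H -
      ε • (stretchPivotMatrix idx H j₀ j₁ j₂ a b).col (some u) ∈ K := by
  have h2 := fun i hi => hrec i hi 2 (by norm_num) (by norm_num)
  by_cases ha : idx u = a
  · exact h.column_mem_left hK P h0 h1 h2 ha
  by_cases hb : idx u = b
  · have := h.column_mem_left hK P.symm h0 h1 h2 hb
    rwa [stretchPivotMatrix_symm] at this
  by_cases hj : idx u = idx j₀
  · rcases (P.fiber u).1 hj with rfl | rfl | rfl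
    · exact h.column_mem_hub hK P h0 h1 fun i hi => hrec i hi 3 (by norm_num) le_rfl
    · exact h.column_mem_wing₁ hK P h0 h1 h2
    · have := h.column_mem_wing₁ hK P.symm h0 h1 h2
      rwa [stretchPivotMatrix_symm] at this
  · rw [P.col_other ha hb hj, smul_zero, add_zero, sub_zero]
    by_cases hu : idx u ∈ I
    · exact h.column_mem_of_mem hK (fun i hi => by
        simpa using hrec i hi 1 le_rfl (by norm_num)) hu
    · exact column_mem_of_notMem hK hI hu

end Columns

end StretchedCliqueGraph

/-! ### Base case, certificate and induction. -/

section StretchedCliqueGraph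

open scoped Classical

variable {V ι : Type*} [Fintype V] {G : SimpleGraph V} {idx : V → ι} {H : Finset V} {I : Finset ι}

/-- On an edge at a hub, `ε` is subtracted on both sides. For an edge of two non-hubs, a third index
`i ∈ I` yields the summand `onSet idx H i`, which avoids both ends and leaves slack `1 ≥ ε`. -/
theorem IsStretchedCliqueGraph.sum_sub_mem_homCone_fracStab (h : IsStretchedCliqueGraph G idx H)
    (hI : 3 ≤ I.card) {ε : ℝ} (h1 : ε ≤ 1 / 2) :
    ∑ S ∈ maxStableSets G idx H I, homIncidence S - ε • homIncidence H ∈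
      homCone (fracStab G) := by
  set Z := maxStableSets G idx H I
  have hex : ∀ p q : ι, ∃ i ∈ I, i ≠ p ∧ i ≠ q := by
    intro p q
    have : ({p, q} : Finset ι).card < I.card := Finset.card_le_two.trans_lt hI
    obtain ⟨i, hi, hi'⟩ := Finset.exists_mem_notMem_of_card_lt_card this
    exact ⟨i, hi, by simpa using hi'⟩
  have hle : ∀ f : Finset V → ℝ, (∀ S ∈ Z, 0 ≤ f S) → ∀ i ∈ I, f (onSet idx H i) = 1 →
      1 ≤ ∑ S ∈ Z, f S := by
    intro f hf i hi hfi
    rw [← hfi]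
    exact Finset.single_le_sum hf (h.onSet_mem_maxStableSets hi)
  have hnone : (∑ S ∈ Z, homIncidence S - ε • homIncidence H) none = ∑ S ∈ Z, (1 : ℝ) - ε := by
    simp [Finset.sum_apply]
  have hsome : ∀ u, (∑ S ∈ Z, homIncidence S - ε • homIncidence H) (some u) =
      ∑ S ∈ Z, (if u ∈ S then (1 : ℝ) else 0) - if u ∈ H then ε else 0 := by
    intro u
    simp only [Pi.sub_apply, Finset.sum_apply, Pi.smul_apply, homIncidence_some, smul_eq_mul,
      mul_ite, mul_one, mul_zero]
  have hoff : ∀ u, u ∉ H → ∀ i, i ≠ idx u → u ∉ onSet idx H i := by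
    intro u hu i hi
    rw [mem_onSet]
    tauto
  have hpair : ∀ u v, G.Adj u v →
      (∑ S ∈ Z, homIncidence S - ε • homIncidence H) (some u) +
        (∑ S ∈ Z, homIncidence S - ε • homIncidence H) (some v) ≤
      (∑ S ∈ Z, homIncidence S - ε • homIncidence H) none := by
    intro u v huv
    rw [hnone, hsome, hsome]
    have hnn : ∀ S ∈ Z, (0 : ℝ) ≤ 1 - ((if u ∈ S then 1 else 0) + if v ∈ S then 1 else 0) := by
      intro S hS
      have hind := (mem_maxStableSets.1 hS).1
      split_ifs with hu hv hv
      · exact absurd huv (hind hu hv huv.ne)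
      all_goals norm_num
    have hsum := Finset.sum_nonneg hnn
    by_cases hu : u ∈ H
    · have hv : v ∉ H := ((h.adj_hub u hu v).1 huv).2
      rw [Finset.sum_sub_distrib, Finset.sum_add_distrib] at hsum
      rw [if_pos hu, if_neg hv]
      linarith
    · by_cases hv : v ∈ H
      · rw [Finset.sum_sub_distrib, Finset.sum_add_distrib] at hsum
        rw [if_pos hv, if_neg hu]
        linarith
      · obtain ⟨i, hi, hiu, hiv⟩ := hex (idx u) (idx v)
        have := hle _ hnn i hi (by simp [hoff u hu i hiu, hoff v hv i hiv])
        rw [Finset.sum_sub_distrib, Finset.sum_add_distrib] at this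
        rw [if_neg hu, if_neg hv]
        linarith
  refine mem_homCone_fracStab ?_ (fun u => ?_) (fun u => ?_) hpair
  · obtain ⟨i, hi⟩ := Finset.card_pos.1 (lt_of_lt_of_le (by norm_num) hI)
    have := hle (fun _ => 1) (fun _ _ => zero_le_one) i hi rfl
    rw [hnone]
    linarith
  · rw [hsome]
    have hnn : ∀ S ∈ Z, (0 : ℝ) ≤ if u ∈ S then 1 else 0 := by
      intro S _
      split_ifs <;> norm_num
    by_cases hu : u ∈ H
    · obtain ⟨i, hi, hiu, -⟩ := hex (idx u) (idx u)
      have := hle _ hnn i hi (if_pos (mem_onSet.2 ⟨fun _ => hiu.symm, fun _ => hu⟩))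
      rw [if_pos hu]
      linarith
    · rw [if_neg hu, sub_zero]
      exact Finset.sum_nonneg hnn
  · rw [hnone, hsome]
    have hnn : ∀ S ∈ Z, (0 : ℝ) ≤ 1 - (if u ∈ S then 1 else 0) := by
      intro S _
      split_ifs <;> norm_num
    by_cases hu : u ∈ H
    · have hsum := Finset.sum_nonneg hnn
      rw [Finset.sum_sub_distrib] at hsum
      rw [if_pos hu]
      linarith
    · obtain ⟨i, hi, hiu, -⟩ := hex (idx u) (idx u)
      have := hle _ hnn i hi (by simp [hoff u hu i hiu])
      rw [Finset.sum_sub_distrib] at this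
      rw [if_neg hu]
      linarith

/-- The certificate matrix for `LS₊`. -/
noncomputable def certificate (G : SimpleGraph V) (idx : V → ι) (H : Finset V) (I : Finset ι)
    (j₀ j₁ j₂ : V) (a b : ι) (ε : ℝ) : Matrix (Option V) (Option V) ℝ :=
  ∑ S ∈ maxStableSets G idx H I, Matrix.vecMulVec (homIncidence S) (homIncidence S) -
    ε • Matrix.vecMulVec (homIncidence H) (homIncidence H) +
    ε • stretchPivotMatrix idx H j₀ j₁ j₂ a b

variable {j₀ j₁ j₂ : V} {a b : ι} {ε : ℝ}

theorem certificate_apply (o p : Option V) :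
    certificate G idx H I j₀ j₁ j₂ a b ε o p =
      ∑ S ∈ maxStableSets G idx H I, homIncidence S o * homIncidence S p -
        ε * (homIncidence H o * homIncidence H p) +
        ε * (stretchPivotMatrix idx H j₀ j₁ j₂ a b).col p o := by
  simp [certificate, Matrix.sum_apply, Matrix.vecMulVec_apply]

theorem certificate_col_none :
    (certificate G idx H I j₀ j₁ j₂ a b ε).col none =
      ∑ S ∈ maxStableSets G idx H I, homIncidence S - ε • homIncidence H := by
  funext o
  rw [Matrix.col_apply, certificate_apply, stretchPivotMatrix_col_none]
  simp [Finset.sum_apply]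

theorem certificate_col_some (u : V) :
    (certificate G idx H I j₀ j₁ j₂ a b ε).col (some u) =
      ∑ S ∈ (maxStableSets G idx H I).filter (u ∈ ·), homIncidence S -
        (ε * if u ∈ H then 1 else 0) • homIncidence H +
        ε • (stretchPivotMatrix idx H j₀ j₁ j₂ a b).col (some u) := by
  funext o
  rw [Matrix.col_apply, certificate_apply]
  simp only [homIncidence_some, mul_ite, mul_one, mul_zero, Pi.add_apply, Pi.sub_apply,
    Finset.sum_apply, Pi.smul_apply, smul_eq_mul, Finset.sum_filter]
  have hite : ∀ S : Finset V, (if u ∈ S then homIncidence S else 0) o =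
      if u ∈ S then homIncidence S o else 0 := fun S => by split_ifs <;> rfl
  simp only [hite]
  split_ifs <;> simp

theorem certificate_col_none_sub_col_some (u : V) :
    (certificate G idx H I j₀ j₁ j₂ a b ε).col none -
        (certificate G idx H I j₀ j₁ j₂ a b ε).col (some u) =
      ∑ S ∈ (maxStableSets G idx H I).filter (u ∉ ·), homIncidence S -
        (ε * if u ∈ H then 0 else 1) • homIncidence H -
        ε • (stretchPivotMatrix idx H j₀ j₁ j₂ a b).col (some u) := by
  rw [certificate_col_none, certificate_col_some,
    ← Finset.sum_filter_add_sum_filter_not (maxStableSets G idx H I) (u ∈ ·)]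
  split_ifs <;> module

theorem IsPivot.certificate_diag (P : IsPivot G idx H I j₀ j₁ j₂ a b) :
    (certificate G idx H I j₀ j₁ j₂ a b ε).col none =
      (certificate G idx H I j₀ j₁ j₂ a b ε).diag := by
  -- In every product of `pivotMatrix` the two factors have disjoint supports: fiber `a` or `b`
  -- against the pivot's fiber, or the two different wings.
  have hdiag : ∀ u, (stretchPivotMatrix idx H j₀ j₁ j₂ a b).col (some u) (some u) = 0 := by
    intro u
    have h01 : j₀ ≠ j₁ := fun h => P.wing₁ (h ▸ P.hub)
    have h02 : j₀ ≠ j₂ := fun h => P.wing₂ (h ▸ P.hub)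
    have hwing := P.wing_apply u
    have hwing' := P.symm.wing_apply u
    have hA := P.onSet_sub_swap_apply u
    have hB := P.symm.onSet_sub_swap_apply u
    have hX := IsPivot.onSet_sub_hubs_apply (idx := idx) (H := H) a u
    have hX' := IsPivot.onSet_sub_hubs_apply (idx := idx) (H := H) b u
    rw [P.col_some]
    simp only [Pi.add_apply, Pi.smul_apply, smul_eq_mul, hwing, hwing', hA, hB, hX, hX']
    by_cases hu0 : u = j₀
    · subst hu0
      simp [h01, h02, P.left_ne.symm, P.right_ne.symm]
    by_cases hu1 : u = j₁
    · subst hu1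
      simp [hu0, P.wing_ne, P.idx_wing₁, P.left_ne.symm]
    by_cases hu2 : u = j₂
    · subst hu2
      simp [hu0, hu1, P.idx_wing₂, P.right_ne.symm]
    simp [hu0, hu1, hu2]
  funext o
  rcases o with _ | u
  · rfl
  · rw [Matrix.diag_apply, certificate_apply, hdiag, certificate_col_none]
    simp only [Pi.sub_apply, Finset.sum_apply, Pi.smul_apply, smul_eq_mul, mul_zero, add_zero,
      homIncidence_some, mul_ite, mul_one]
    congr 1
    · exact Finset.sum_congr rfl fun S _ => by split_ifs <;> rfl
    · split_ifs <;> rfl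

theorem IsStretchedCliqueGraph.certificate_posSemidef (h : IsStretchedCliqueGraph G idx H)
    (P : IsPivot G idx H I j₀ j₁ j₂ a b) (h0 : 0 ≤ ε) (h1 : ε ≤ 1 / 200) :
    (certificate G idx H I j₀ j₁ j₂ a b ε).PosSemidef :=
  posSemidef_pivot _ _ _ _ _ _ _ _ ⟨_, h.onSet_mem_maxStableSets P.left_mem, rfl⟩
    ⟨_, h.onSet_mem_maxStableSets P.right_mem, rfl⟩ ⟨_, h.onSet_mem_maxStableSets P.idx_mem, rfl⟩
    ⟨_, h.swap_mem_maxStableSets P, rfl⟩ ⟨_, h.swap_mem_maxStableSets P.symm, rfl⟩ h0 h1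

/-- Removing an index from `I` and lowering `m` by one preserves both size conditions. The factor `3
^ m` is the reserve for the growth of `ε` by up to `3` in each round. -/
theorem IsStretchedCliqueGraph.sum_sub_mem_homCone (h : IsStretchedCliqueGraph G idx H) (m : ℕ)
    (I : Finset ι) (hI : m + 3 ≤ I.card)
    (hclique : ∀ s : Finset V, G.IsClique (s : Set V) → (∀ u ∈ s, idx u ∈ I) →
      m + s.card ≤ I.card)
    (ε : ℝ) (h0 : 0 < ε) (h1 : ε * 3 ^ m ≤ 1 / 200) :
    ∑ S ∈ maxStableSets G idx H I, homIncidence S - ε • homIncidence H ∈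
      homCone (LSplus^[m] (fracStab G)) := by
  induction m generalizing I ε with
  | zero =>
    rw [pow_zero, mul_one] at h1
    exact h.sum_sub_mem_homCone_fracStab (by omega) (h1.trans (by norm_num))
  | succ m ih =>
    obtain ⟨j₀, j₁, j₂, a, b, P⟩ := h.exists_isPivot (I := I) fun s hs hsI => by
      have := hclique s hs hsI
      omega
    have hpow : (1 : ℝ) ≤ 3 ^ m := one_le_pow₀ (by norm_num)
    rw [pow_succ] at h1
    have h1' : ε ≤ 1 / 200 := by nlinarith
    have hstable : ∀ S : Finset V, G.IsIndepSet (S : Set V) →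
        incidence (S : Set V) ∈ LSplus^[m] (fracStab G) := fun S hS =>
      mem_iterate_LSplus_of_zero_one (incidence_mem_fracStab_iff.2 hS)
        (incidence_eq_zero_or_one _) m
    let K := homPointedCone (LSplus^[m] (fracStab G))
      (convex_iterate_LSplus (convex_fracStab G) m) ⟨_, hstable H h.isIndepSet_hubs⟩
    have hcol := h.column_mem (K := K) (fun S hS => mem_homCone_of_one (hstable S hS)) P h0.le
      (h1'.trans (by norm_num))
      -- The same `I` one level lower serves the vertices whose index lies outside `I`.
      (ih I (by omega) (fun s hs hsI => by have := hclique s hs hsI; omega) ε h0 (by nlinarith))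
      (fun i hi r hr hr' => by
        have hcard := Finset.card_erase_add_one hi
        refine ih (I.erase i) (by omega) (fun s hs hsI => ?_) (r * ε) (by positivity) ?_
        · have := hclique s hs fun u hu => Finset.mem_of_mem_erase (hsI u hu)
          omega
        · have := mul_le_mul_of_nonneg_right hr' (mul_nonneg h0.le (zero_le_one.trans hpow))
          linarith)
    rw [Function.iterate_succ_apply', ← certificate_col_none (j₀ := j₀) (j₁ := j₁) (j₂ := j₂)
      (a := a) (b := b)]
    refine col_none_mem_homCone_LSplus ⟨h.certificate_posSemidef P h0.le h1', P.certificate_diag,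
      fun u => ?_⟩ ?_
    · rw [certificate_col_none_sub_col_some, certificate_col_some]
      exact hcol u
    · have h2 := congrFun (certificate_col_none (G := G) (idx := idx) (H := H) (I := I) (j₀ := j₀)
        (j₁ := j₁) (j₂ := j₂) (a := a) (b := b) (ε := ε)) none
      rw [Matrix.col_apply] at h2
      have hne : (1 : ℝ) ≤ (maxStableSets G idx H I).card := by
        exact_mod_cast Finset.card_pos.2 ⟨_, h.onSet_mem_maxStableSets P.left_mem⟩
      rw [h2]
      simp only [Pi.sub_apply, Finset.sum_apply, homIncidence_none, Finset.sum_const,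
        nsmul_eq_mul, mul_one, Pi.smul_apply, smul_eq_mul]
      linarith

end StretchedCliqueGraph

/-! ### The rank bound and the theorem. -/

/-- If a point of the homogenized cone of `LS₊^m` of the fractional stable set polytope violates
the rank inequality, then the `LS₊`-rank of the graph is larger than `m`. -/
theorem lt_graphLSplusRank {V : Type*} [Fintype V] [Nonempty V] {G : SimpleGraph V} {m : ℕ}
    {y : Option V → ℝ} (hy : y ∈ homCone (LSplus^[m] (fracStab G)))
    (hviol : (G.indepNum : ℝ) * y none < ∑ v, y (some v)) :
    ((m + 1 : ℕ) : ℕ∞) ≤ graphLSplusRank G := by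
  classical
  refine le_iInf₂ fun l hl => ?_
  rw [Nat.cast_le]
  by_contra! hlt
  obtain ⟨t, ht, x, hx, h0, hsome⟩ := hy
  -- The iterates decrease, so if level `l ≤ m` were already the integer hull, it would contain `x`;
  -- but the rank inequality holds on the hull.
  have hx' : x ∈ integerHull (fracStab G) := by
    rw [← hl]
    exact antitone_iterate_LSplus (convex_fracStab G) (Nat.le_of_lt_succ hlt) hx
  have hle : integerHull (fracStab G) ⊆ {x | ∑ v, x v ≤ G.indepNum} := by
    refine convexHull_min ?_ ?_
    · rintro z ⟨hz, h01⟩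
      have hzS : z = incidence ((Finset.univ.filter fun v => z v = 1 : Finset V) : Set V) := by
        funext v
        rw [incidence_apply]
        rcases h01 v with hv | hv <;> simp [hv]
      rw [hzS] at hz
      have := SimpleGraph.IsIndepSet.card_le_indepNum (incidence_mem_fracStab_iff.1 hz)
      rw [Set.mem_ofPred_eq, hzS]
      simp only [incidence_apply, Finset.mem_coe, Finset.sum_ite_mem, Finset.univ_inter,
        Finset.sum_const, nsmul_eq_mul, mul_one]
      exact_mod_cast this
    · refine convex_halfSpace_le (𝕜 := ℝ) ⟨fun x y => ?_, fun c x => ?_⟩ _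
      · simp [Finset.sum_add_distrib]
      · simp [Finset.mul_sum]
  have h1 : ∑ v, x v ≤ G.indepNum := hle hx'
  rw [h0] at hviol
  simp only [hsome, ← Finset.mul_sum] at hviol
  nlinarith

theorem faceSum_fracStab_eq {V ι : Type*} [Fintype V] (G : SimpleGraph V) (idx : V → ι)
    (H : Finset V) (I : Finset ι) (hI : ∀ i, i ∈ I) :
    faceSum (fracStab G) (fun _ => 1) (H.card + 1) =
      ∑ S ∈ maxStableSets G idx H I, homIncidence S := by
  classical
  have hmem : ∀ S : Finset V, S ∈ maxStableSets G idx H I ↔ incidence (S : Set V) ∈ fracStab G ∧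
      ∑ i, (1 : ℝ) * incidence (S : Set V) i = (H.card : ℝ) + 1 := by
    intro S
    rw [mem_maxStableSets, incidence_mem_fracStab_iff]
    simp only [incidence_apply, Finset.mem_coe, one_mul, Finset.sum_ite_mem, Finset.univ_inter,
      Finset.sum_const, nsmul_eq_mul, mul_one, hI, not_true_eq_false, false_imp_iff,
      imp_true_iff, and_true]
    norm_cast
  unfold faceSum
  symm
  -- The index in `faceSum` has type `Set V`; the coercion from `Finset V` is the bijection.
  refine Finset.sum_bij (fun S _ => (S : Set V)) (fun S hS => ?_)
    (fun S _ T _ hST => Finset.coe_injective hST) (fun S hS => ?_) fun _ _ => rfl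
  · rw [Finset.mem_filter]
    exact ⟨by simp, (hmem S).1 hS⟩
  · rw [Finset.mem_filter] at hS
    have hcoe : ((S.toFinset : Finset V) : Set V) = S := Set.coe_toFinset S
    exact ⟨S.toFinset, (hmem _).2 (by rw [hcoe]; exact hS.2), hcoe⟩

theorem theorem4p9 {n d : ℕ} (hn : 3 ≤ n) {V : Type*} [Fintype V] (G : SimpleGraph V)
    (label : V → CliqueLabel n) (hG : IsHatStretchedClique n d G label)
    (k : ℕ) (hk : k = max 3 G.cliqueNum) :
    k ≤ n ∧ G.indepNum = d + 1 ∧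
    (∃ ε : ℝ, 0 < ε ∧
      stretchPoint d G label ε ∈ homCone (LSplus^[n - k] (fracStab G)) ∧
      ((d : ℝ) + 1) * stretchPoint d G label ε none
        < ∑ v, stretchPoint d G label ε (some v)) ∧
    ((n - k + 1 : ℕ) : ℕ∞) ≤ graphLSplusRank G := by
  classical
  obtain ⟨hstr, hat⟩ := hG
  obtain ⟨D, hD, hL⟩ := hstr.exists_labelling
  let H : Finset V := Finset.univ.filter fun v => (label v).IsHub
  have hH : ∀ v, v ∈ H ↔ (label v).IsHub := fun v => by simp [H]
  have h := hL.isStretchedCliqueGraph H hH hat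
  have hcard : H.card = d := (hL.card_hubs H hH).trans hD
  have : Nonempty (Fin n) := ⟨⟨0, by omega⟩⟩
  have hkn : k ≤ n := by
    have := h.cliqueNum_le (by simpa using by omega)
    rw [Fintype.card_fin] at this
    omega
  have hind : G.indepNum = d + 1 := by rw [h.indepNum_eq, hcard]
  have hhubs : hubs label = (H : Set V) := by
    ext v
    rw [Finset.mem_coe, hH]
    change (∃ i, label v = .stretched i 0) ↔ _
    rcases label v with i | ⟨i, j⟩ <;> simp [CliqueLabel.IsHub]
  have hpt : ∀ ε, stretchPoint d G label ε =
      ∑ S ∈ maxStableSets G (fun v => (label v).idx) H Finset.univ, homIncidence S -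
        ε • homIncidence H := by
    intro ε
    rw [stretchPoint, hhubs, ← hcard, faceSum_fracStab_eq G _ H _ fun i => Finset.mem_univ (α := Fin n) i]
    rfl
  have hsum : ∀ S : Finset V, ∑ v, homIncidence S (some v) = S.card := by
    intro S
    simp [homIncidence_some]
  -- The stable sets in the sum give equality; the subtracted hub vector has coordinate sum `d`
  -- only, so the excess is exactly `ε`.
  have hviol : ∀ ε : ℝ, 0 < ε → ((d : ℝ) + 1) * stretchPoint d G label ε none <
      ∑ v, stretchPoint d G label ε (some v) := by
    intro ε hε
    rw [hpt]
    simp only [Pi.sub_apply, Finset.sum_apply, Pi.smul_apply, homIncidence_none, smul_eq_mul,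
      Finset.sum_sub_distrib, ← Finset.mul_sum, hsum, hcard, mul_one]
    rw [Finset.sum_comm]
    simp only [hsum]
    have hconst : ∀ S ∈ maxStableSets G (fun v => (label v).idx) H Finset.univ,
        (S.card : ℝ) = d + 1 := fun S hS => by
      rw [(mem_maxStableSets.1 hS).2.1, hcard, Nat.cast_add_one]
    rw [Finset.sum_congr rfl hconst]
    simp only [Finset.sum_const, nsmul_eq_mul, mul_one]
    linarith
  have hmem : stretchPoint d G label (1 / 200 / 3 ^ (n - k)) ∈
      homCone (LSplus^[n - k] (fracStab G)) := by
    rw [hpt]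
    -- With `I` the set of all indices, the two size conditions follow from `3 ≤ k` and `G.cliqueNum
    -- ≤ k`.
    refine h.sum_sub_mem_homCone (n - k) _ ?_ (fun s hs _ => ?_) _ (by positivity) ?_
    · rw [Finset.card_univ, Fintype.card_fin]
      omega
    · have := SimpleGraph.IsClique.card_le_cliqueNum (tc := hs)
      rw [Finset.card_univ, Fintype.card_fin]
      omega
    · rw [div_mul_cancel₀ _ (by positivity)]
  have : Nonempty V := by
    obtain ⟨u, -⟩ := h.cross ⟨0, by omega⟩ ⟨1, by omega⟩ (by simp)
    exact ⟨u⟩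
  refine ⟨hkn, hind, ⟨_, by positivity, hmem, hviol _ (by positivity)⟩,
    lt_graphLSplusRank hmem ?_⟩
  have := hviol (1 / 200 / 3 ^ (n - k)) (by positivity)
  rw [hind]
  push_cast
  exact this
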